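/- Let $N \cong \mathbb{Z}^2$ be a lattice of rank $2$, $M = \mathrm{Hom}(N,\mathbb{Z})$ its dual lattice, $N_{\mathbb R} = N\otimes\mathbb{R}$, $M_{\mathbb R} = M\otimes\mathbb{R}$, and $\langle\cdot,\cdot\rangle : M_{\mathbb R}\times N_{\mathbb R}\to\mathbb{R}$ the natural pairing. Let $\Delta\subseteq N_{\mathbb R}$ be an LDP-polygon, i.e. a convex lattice polygon (the convex hull of finitely many points of $N$) that contains the origin in its interior and whose vertices are primitive lattice points of $N$. Let $\Sigma$ be the fan of cones over the proper faces of $\Delta$ (the fan of the corresponding toric log del Pezzo surface), and let $\Delta^* = \{y\in M_{\mathbb R} \mid \langle y,x\rangle\ge -1 \text{ for all } x\in\Delta\}$ be the dual polygon. For a polygon $P$ in $N_{\mathbb R}$ or $M_{\mathbb R}$ let $v(P) = 2!\cdot\mathrm{vol}_2(P)$ be its normalized area, where $\mathrm{vol}_2$ is normalized so that a fundamental parallelogram of the lattice $N$, respectively $M$, has area $1$. There is exactly one function $\kappa : N_{\mathbb R}\to\mathbb{R}$ that is linear on every cone of $\Sigma$ and takes the value $-1$ on the primitive lattice generator of every one-dimensional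 cone of $\Sigma$ (the piecewise linear function of the anticanonical divisor); the set $\Delta\cap N$ is finite; and $$v(\Delta) + v(\Delta^*) = 12\sum_{n\in\Delta\cap N}(\kappa(n)+1)^2 .$$ In particular $v(\Delta)+v(\Delta^*)\ge 12$, and equality holds if and only if $\Delta$ is reflexive, i.e. if and only if all vertices of $\Delta^*$ belong to $M$. -/

import Mathlib

open MeasureTheory Module

noncomputable section

namespace LDP

variable {E : Type*} [NormedAddCommGroup E] [NormedSpace ℝ E]

/-- A primitive vector of the lattice `N`: a nonzero lattice vector that is not a proper integral
multiple of another lattice vector. -/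
def IsPrimitive (N : Submodule ℤ E) (u : E) : Prop :=
  u ∈ N ∧ u ≠ 0 ∧ ∀ w ∈ N, ∀ k : ℤ, u = k • w → IsUnit k

/-- The vertices of a convex set, as its extreme points. -/
def vertices (P : Set E) : Set E := P.extremePoints ℝ

/-- A lattice polytope: the convex hull of finitely many lattice points. -/
def IsLatticePolytope (N : Submodule ℤ E) (P : Set E) : Prop :=
  ∃ s : Finset E, (s : Set E) ⊆ N ∧ P = convexHull ℝ (s : Set E)

/-- An LDP-polytope: a convex lattice polytope with the origin in its interior, all of whose
vertices are primitive lattice points. It is an LDP-polygon if the ambient space is a plane. -/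
structure IsLDP (N : Submodule ℤ E) (P : Set E) : Prop where
  isLatticePolytope : IsLatticePolytope N P
  zero_mem_interior : (0 : E) ∈ interior P
  primitive_vertices : ∀ u ∈ vertices P, IsPrimitive N u

/-- The fan of cones over the proper faces of `P` (the empty face gives the cone `{0}`). -/
def faceFan (P : Set E) : Set (PointedCone ℝ E) :=
  {σ | ∃ F : Set E, IsExposed ℝ P F ∧ F ≠ P ∧ σ = PointedCone.hull ℝ F}

/-- The dimension of a cone. -/
def coneDim (σ : PointedCone ℝ E) : ℕ := finrank ℝ (Submodule.span ℝ (σ : Set E))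

/-- `κ` is the piecewise linear function of the anticanonical divisor of the fan `Fan`: it is
linear on every cone and takes the value `-1` on the primitive lattice generator of every
one-dimensional cone. -/
structure IsAnticanonical (N : Submodule ℤ E) (Fan : Set (PointedCone ℝ E)) (κ : E → ℝ) :
    Prop where
  linear_on_cone : ∀ σ ∈ Fan, ∃ m : E →ₗ[ℝ] ℝ, ∀ x ∈ σ, κ x = m x
  ray_generator : ∀ σ ∈ Fan, coneDim σ = 1 → ∀ u ∈ σ, IsPrimitive N u → κ u = -1

/-- The dual lattice `M = Hom(N, ℤ)`, inside the dual space. -/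
def dualLattice (N : Submodule ℤ E) : Submodule ℤ (StrongDual ℝ E) where
  carrier := {y | ∀ n ∈ N, ∃ k : ℤ, y n = k}
  zero_mem' := fun _ _ => ⟨0, by simp⟩
  add_mem' := by
    intro a b ha hb n hn
    obtain ⟨k, hk⟩ := ha n hn
    obtain ⟨l, hl⟩ := hb n hn
    exact ⟨k + l, by simp [hk, hl]⟩
  smul_mem' := by
    intro c a ha n hn
    obtain ⟨k, hk⟩ := ha n hn
    exact ⟨c * k, by simp [hk]⟩

/-- The dual polytope `{y | ⟨y, x⟩ ≥ -1 for all x ∈ P}`. -/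
def dualPolytope (P : Set E) : Set (StrongDual ℝ E) :=
  {y | ∀ x ∈ P, -1 ≤ y x}

/-- `P` is reflexive if all vertices of its dual polytope are points of the dual lattice. -/
def IsReflexive (N : Submodule ℤ E) (P : Set E) : Prop :=
  vertices (dualPolytope P) ⊆ (dualLattice N : Set (StrongDual ℝ E))

/-- The normalized volume `d! · vol_d`, where `vol_d` is the Haar measure for which a fundamental
parallelepiped of the lattice `L` has volume one. -/
def normalizedVolume {V : Type*} [NormedAddCommGroup V] [NormedSpace ℝ V] [FiniteDimensional ℝ V]
    [MeasurableSpace V] [BorelSpace V] (L : Submodule ℤ V) (P : Set V) : ℝ :=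
  (finrank ℝ V).factorial *
    ((Measure.addHaar : Measure V).real P / ZLattice.covolume L (Measure.addHaar : Measure V))

end LDP

end

/-! Cut `Δ` into triangles spanned by the origin and its edges `(u, v)`, and put `d = det(u, v)`;
the normalized area of `Δ` is the sum of the `d`. On the cone over an edge, `κ` is minus the form
`edgeForm` that equals 1 at `u` and `v`. The origin contributes 1 to the sum of `(κ + 1)²` and the
vertices contribute 0; since vertices are primitive, no other nonzero lattice point of `Δ` lies on a
ray. In an open cone, a lattice basis `u, u*` with `v = h u + d u*` turns the contribution into half
of the sum of `({hj/d} - j/d)²` over `0 < j < d`. Expanding gives `12 * edgeSum = d + 2/d - 3 - 12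
s(h, d)` with a Dedekind sum `s` (`exists_sum_triangle`, `sum_fract_sub_sq`,
`sum_fract_sub_sq_filter`).

What remains is that 12 plus the sum of all `2/d - 3 - 12 s(h, d)` is the normalized area of `Δ*`:
Noether's formula, `IsPolygon.noether`. The three-term law `dedekindSum_three_term`, a consequence
of reciprocity, writes `s(h, d)` as a difference of Dedekind sums attached to the two vertices, plus
a sign and a rational term. Around the polygon the differences cancel, the signs count the two edges
crossed by a line through the origin and account for the 12, and the rational terms assemble into
the areas of the triangles of `Δ*`, one for each vertex of `Δ`.

The total is thus 12 plus 12 times a sum of squares, which gives the inequality. Equality means that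
every edge contribution vanishes. If the dual vertex of an edge is integral, its form can only be 1
at lattice points of `Δ` in the open cone, so the contribution vanishes; conversely the term `j = 1`
alone forces `h ≡ 1` mod `d`, hence `v - u ∈ dN`, which makes the dual vertex integral. The vertices
of `Δ*` are exactly these dual vertices. -/

namespace LDP

/-! ### Dedekind sums and their symmetries -/

/-- The sawtooth function: `x - ⌊x⌋ - 1/2` off the integers and `0` on them. -/
noncomputable def saw (x : ℝ) : ℝ := if Int.fract x = 0 then 0 else Int.fract x - 1 / 2

lemma saw_add_int (x : ℝ) (n : ℤ) : saw (x + n) = saw x := by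
  simp [saw]

lemma saw_int (n : ℤ) : saw n = 0 := by simp [saw]

lemma saw_neg (x : ℝ) : saw (-x) = -saw x := by
  unfold saw
  by_cases h : Int.fract x = 0
  · simp [h, Int.fract_neg_eq_zero]
  · rw [if_neg h, if_neg (by rwa [Int.fract_neg_eq_zero]), Int.fract_neg h]
    ring

/-- The Dedekind sum `s(h, k)`, extended to negative moduli as an odd function of `k`. -/
noncomputable def dedekindSum (h k : ℤ) : ℝ :=
  k.sign * ∑ j ∈ Finset.Ico (0 : ℤ) |k|, saw (j / k) * saw (h * j / k)

lemma dedekindSum_one (h : ℤ) : dedekindSum h 1 = 0 := by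
  have : Finset.Ico (0 : ℤ) 1 = {0} := by decide
  simp [dedekindSum, this, saw]

lemma dedekindSum_neg_left (h k : ℤ) : dedekindSum (-h) k = -dedekindSum h k := by
  unfold dedekindSum
  rw [← mul_neg, ← Finset.sum_neg_distrib]
  congr 1
  refine Finset.sum_congr rfl fun j _ => ?_
  rw [← mul_neg, ← saw_neg]
  congr 2
  push_cast
  ring

lemma dedekindSum_neg_right (h k : ℤ) : dedekindSum h (-k) = -dedekindSum h k := by
  unfold dedekindSum
  rw [Int.sign_neg, abs_neg]
  push_cast
  rw [neg_mul]
  congr 2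
  refine Finset.sum_congr rfl fun j _ => ?_
  rw [div_neg, div_neg, saw_neg, saw_neg]
  ring

lemma saw_div_congr {k a b : ℤ} (hk : k ≠ 0) (h : k ∣ a - b) :
    saw ((a : ℝ) / k) = saw ((b : ℝ) / k) := by
  obtain ⟨c, hc⟩ := h
  have hk' : (k : ℝ) ≠ 0 := by exact_mod_cast hk
  have : (a : ℝ) / k = b / k + c := by
    have h2 : (a : ℝ) - b = k * c := by exact_mod_cast hc
    field_simp
    linarith
  rw [this, saw_add_int]

lemma dedekindSum_congr {h h' k : ℤ} (hk : k ∣ h - h') : dedekindSum h k = dedekindSum h' k := by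
  rcases eq_or_ne k 0 with rfl | hk0
  · simp [dedekindSum]
  unfold dedekindSum
  congr 1
  refine Finset.sum_congr rfl fun j _ => ?_
  congr 1
  have := saw_div_congr (a := h * j) (b := h' * j) hk0 (by rw [← sub_mul]; exact hk.mul_right j)
  push_cast at this
  exact this

/-- Multiplication by the unit `h` permutes the residues mod `k`, with inverse multiplication by
`h'`. -/
lemma sum_Ico_mul_of_periodic {k h h' : ℤ} (hk : 0 < k) (hh : k ∣ h * h' - 1) (f : ℤ → ℝ)
    (hf : ∀ a b, k ∣ a - b → f a = f b) :
    ∑ j ∈ Finset.Ico 0 k, f (h * j) = ∑ j ∈ Finset.Ico 0 k, f j := by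
  have key : ∀ a c d : ℤ, k ∣ c * d - 1 → a ∈ Finset.Ico 0 k → c * (d * a % k) % k = a := by
    intro a c d hcd ha
    rw [Finset.mem_Ico] at ha
    obtain ⟨z, hz⟩ := hcd
    rw [Int.mul_emod, Int.emod_emod_of_dvd _ dvd_rfl, ← Int.mul_emod]
    have : c * (d * a) = a + k * (z * a) := by linear_combination a * hz
    rw [this, Int.add_mul_emod_self_left, Int.emod_eq_of_lt ha.1 ha.2]
  refine Finset.sum_nbij' (fun j => h * j % k) (fun j => h' * j % k) ?_ ?_ ?_ ?_ ?_
  · intro a _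
    exact Finset.mem_Ico.2 ⟨Int.emod_nonneg _ hk.ne', Int.emod_lt_of_pos _ hk⟩
  · intro a _
    exact Finset.mem_Ico.2 ⟨Int.emod_nonneg _ hk.ne', Int.emod_lt_of_pos _ hk⟩
  · intro a ha
    exact key a h' h (by rwa [mul_comm]) ha
  · intro a ha
    exact key a h h' hh ha
  · intro a _
    exact hf _ _ (Int.dvd_self_sub_emod)

/-- Reindexing by `j ↦ h j` exchanges the two sawtooth factors. -/
lemma dedekindSum_inv {h h' k : ℤ} (hk : k ∣ h * h' - 1) :
    dedekindSum h k = dedekindSum h' k := by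
  have pos : ∀ k : ℤ, 0 < k → k ∣ h * h' - 1 → dedekindSum h k = dedekindSum h' k := by
    intro k hk0 hk
    unfold dedekindSum
    rw [abs_of_pos hk0]
    congr 1
    have := sum_Ico_mul_of_periodic hk0 hk
      (fun j => saw ((j : ℤ) / k) * saw (((h' * j : ℤ) : ℝ) / k)) (by
        intro a b hab
        rw [saw_div_congr hk0.ne' hab,
          saw_div_congr (a := h' * a) (b := h' * b) hk0.ne'
            (by rw [← mul_sub]; exact hab.mul_left _)])
    push_cast at this
    rw [← this]
    refine Finset.sum_congr rfl fun j _ => ?_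
    rw [mul_comm]
    congr 1
    have h3 := saw_div_congr (a := j) (b := h' * (h * j)) hk0.ne' (by
      have : j - h' * (h * j) = (h * h' - 1) * (-j) := by ring
      rw [this]
      exact hk.mul_right _)
    push_cast at h3
    exact h3
  rcases lt_trichotomy k 0 with hk0 | rfl | hk0
  · have := pos (-k) (by omega) ((neg_dvd).2 hk)
    rw [dedekindSum_neg_right, dedekindSum_neg_right] at this
    linarith
  · simp [dedekindSum]
  · exact pos k hk0 hk

/-! ### Power sums and the reciprocity law -/

lemma sum_range_cast (k : ℕ) : ∑ j ∈ Finset.range k, (j : ℝ) = k * (k - 1) / 2 := by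
  induction k with
  | zero => simp
  | succ n ih => rw [Finset.sum_range_succ, ih]; push_cast; ring

lemma sum_range_sq (k : ℕ) :
    ∑ j ∈ Finset.range k, (j : ℝ) ^ 2 = k * (k - 1) * (2 * k - 1) / 6 := by
  induction k with
  | zero => simp
  | succ n ih => rw [Finset.sum_range_succ, ih]; push_cast; ring

lemma sum_Ico_eq_sum_range (k : ℤ) (f : ℤ → ℝ) :
    ∑ j ∈ Finset.Ico 0 k, f j = ∑ j ∈ Finset.range k.toNat, f j := by
  refine Finset.sum_nbij' Int.toNat (fun n => (n : ℤ)) ?_ ?_ ?_ ?_ ?_ <;>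
    simp +contextual

lemma sum_Ico_cast {k : ℤ} (hk : 0 < k) :
    ∑ j ∈ Finset.Ico 0 k, (j : ℝ) = k * (k - 1) / 2 := by
  rw [sum_Ico_eq_sum_range k (fun j => (j : ℝ))]
  have := sum_range_cast k.toNat
  have h2 : ((k.toNat : ℤ) : ℝ) = k := by rw [Int.toNat_of_nonneg hk.le]
  push_cast at h2 this ⊢
  rw [this, h2]

lemma sum_Ico_sq {k : ℤ} (hk : 0 < k) :
    ∑ j ∈ Finset.Ico 0 k, (j : ℝ) ^ 2 = k * (k - 1) * (2 * k - 1) / 6 := by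
  rw [sum_Ico_eq_sum_range k (fun j => (j : ℝ) ^ 2)]
  have := sum_range_sq k.toNat
  have h2 : ((k.toNat : ℤ) : ℝ) = k := by rw [Int.toNat_of_nonneg hk.le]
  push_cast at h2 this ⊢
  rw [this, h2]

lemma sum_Ico_eq_sum_Ioo {k : ℤ} (hk : 0 < k) (f : ℤ → ℝ) :
    ∑ j ∈ Finset.Ico 0 k, f j = f 0 + ∑ j ∈ Finset.Ioo 0 k, f j := by
  rw [← Finset.Ioo_insert_left hk, Finset.sum_insert (by simp)]

lemma floor_cast_div (a : ℤ) {k : ℤ} (hk : 0 < k) : ⌊(a : ℝ) / k⌋ = a / k := by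
  have hk' : (0 : ℝ) < k := by exact_mod_cast hk
  rw [Int.floor_eq_iff]
  constructor
  · rw [le_div_iff₀ hk']
    exact_mod_cast Int.ediv_mul_le a hk.ne'
  · rw [div_lt_iff₀ hk']
    exact_mod_cast Int.lt_ediv_add_one_mul_self a hk

lemma fract_cast_div (a : ℤ) {k : ℤ} (hk : 0 < k) :
    Int.fract ((a : ℝ) / k) = a / k - (a / k : ℤ) := by
  rw [Int.fract, floor_cast_div a hk]

lemma not_dvd_mul_of_mem_Ioo {h k j : ℤ} (hc : IsCoprime h k) (hj : j ∈ Finset.Ioo 0 k) :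
    ¬ k ∣ h * j := by
  intro hd
  rw [Finset.mem_Ioo] at hj
  have := Int.le_of_dvd hj.1 (hc.symm.dvd_of_dvd_mul_left hd)
  omega

lemma fract_cast_div_eq_zero_iff (a : ℤ) {k : ℤ} (hk : 0 < k) :
    Int.fract ((a : ℝ) / k) = 0 ↔ k ∣ a := by
  have hk' : (k : ℝ) ≠ 0 := by exact_mod_cast hk.ne'
  rw [fract_cast_div a hk, sub_eq_zero, div_eq_iff hk']
  constructor
  · intro h
    exact ⟨a / k, by rw [mul_comm]; exact_mod_cast h⟩
  · intro h
    exact_mod_cast (Int.ediv_mul_cancel h).symm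

lemma saw_mul_div {h k j : ℤ} (hc : IsCoprime h k) (hj : j ∈ Finset.Ioo 0 k) :
    saw ((h * j : ℝ) / k) = h * j / k - (h * j / k : ℤ) - 1 / 2 := by
  have hk : 0 < k := by rw [Finset.mem_Ioo] at hj; omega
  have h1 := fract_cast_div (h * j) hk
  have h2 := mt (fract_cast_div_eq_zero_iff (h * j) hk).1 (not_dvd_mul_of_mem_Ioo hc hj)
  push_cast at h1 h2
  rw [saw, if_neg h2, h1]

lemma saw_div {k j : ℤ} (hj : j ∈ Finset.Ioo 0 k) : saw ((j : ℝ) / k) = j / k - 1 / 2 := by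
  have h := saw_mul_div (isCoprime_one_left : IsCoprime 1 k) hj
  rw [Finset.mem_Ioo] at hj
  rw [one_mul, Int.ediv_eq_zero_of_lt hj.1.le hj.2] at h
  simpa using h

lemma dedekindSum_eq_sum_Ioo {h k : ℤ} (hk : 0 < k) (hc : IsCoprime h k) :
    dedekindSum h k =
      ∑ j ∈ Finset.Ioo 0 k, ((j : ℝ) / k - 1 / 2) * (h * j / k - (h * j / k : ℤ) - 1 / 2) := by
  rw [dedekindSum, abs_of_pos hk, Int.sign_eq_one_of_pos hk,
    sum_Ico_eq_sum_Ioo hk (fun j => saw (j / k) * saw (h * j / k))]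
  have : saw 0 = 0 := by simpa using saw_int 0
  simp only [Int.cast_zero, zero_div, this, zero_mul, zero_add, Int.cast_one, one_mul]
  refine Finset.sum_congr rfl fun j hj => ?_
  rw [saw_div hj, saw_mul_div hc hj]

/-- The fractional parts of `hj/k` are those of `j/k` in another order. Linear and quadratic `φ`
give all the relations used below. -/
lemma sum_Ioo_fract {h k : ℤ} (hk : 0 < k) (hc : IsCoprime h k) (φ : ℝ → ℝ) :
    ∑ j ∈ Finset.Ioo 0 k, φ ((h * j : ℝ) / k - (h * j / k : ℤ)) =
      ∑ j ∈ Finset.Ioo 0 k, φ ((j : ℝ) / k) := by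
  obtain ⟨a, b, hab⟩ := hc
  have hper : ∀ x y : ℤ, k ∣ x - y →
      φ (Int.fract ((x : ℝ) / k)) = φ (Int.fract ((y : ℝ) / k)) := by
    rintro x y ⟨c, hcc⟩
    have hk' : (k : ℝ) ≠ 0 := by exact_mod_cast hk.ne'
    have h2 : (x : ℝ) - y = k * c := by exact_mod_cast hcc
    have : (x : ℝ) / k = y / k + c := by
      field_simp
      linarith
    rw [this, Int.fract_add_intCast]
  have key := sum_Ico_mul_of_periodic hk (h := h) (h' := a)
    ⟨-b, by linear_combination hab⟩ (fun j => φ (Int.fract ((j : ℝ) / k))) hper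
  rw [sum_Ico_eq_sum_Ioo hk (fun j => φ (Int.fract (((h * j : ℤ) : ℝ) / k))),
    sum_Ico_eq_sum_Ioo hk (fun j => φ (Int.fract ((j : ℝ) / k)))] at key
  simp only [mul_zero] at key
  have key2 := add_left_cancel key
  rw [Finset.sum_congr rfl fun j hj => by rw [← Int.cast_mul, ← fract_cast_div _ hk]]
  rw [key2]
  refine Finset.sum_congr rfl fun j hj => ?_
  rw [Finset.mem_Ioo] at hj
  rw [fract_cast_div _ hk, Int.ediv_eq_zero_of_lt hj.1.le hj.2]
  simp

lemma sum_Ioo_cast {k : ℤ} (hk : 0 < k) :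
    ∑ j ∈ Finset.Ioo 0 k, (j : ℝ) = k * (k - 1) / 2 := by
  rw [← sum_Ico_cast hk, sum_Ico_eq_sum_Ioo hk (fun j => (j : ℝ))]
  simp

lemma sum_Ioo_sq {k : ℤ} (hk : 0 < k) :
    ∑ j ∈ Finset.Ioo 0 k, (j : ℝ) ^ 2 = k * (k - 1) * (2 * k - 1) / 6 := by
  rw [← sum_Ico_sq hk, sum_Ico_eq_sum_Ioo hk (fun j => (j : ℝ) ^ 2)]
  simp

lemma sum_Ioo_const {k : ℤ} (hk : 0 < k) (c : ℝ) :
    ∑ _j ∈ Finset.Ioo 0 k, c = (k - 1) * c := by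
  rw [Finset.sum_const, Int.card_Ioo, nsmul_eq_mul]
  congr 1
  have : ((k - 0 - 1).toNat : ℤ) = k - 1 := by omega
  exact_mod_cast congrArg (Int.cast : ℤ → ℝ) this

/-- Write `m (m + 1)` as the sum of `2i` over `i ≤ m` and exchange the summations: this counts
lattice points of a rectangle from its other side. Coprimality keeps them off the diagonal. -/
lemma sum_floor_mul_succ {h k : ℤ} (hh : 0 < h) (hk : 0 < k) (hc : IsCoprime h k) :
    ∑ j ∈ Finset.Ioo 0 k, ((h * j / k : ℤ) : ℝ) * ((h * j / k : ℤ) + 1) =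
      ∑ i ∈ Finset.Ioo 0 h, 2 * (i : ℝ) * (k - 1 - (k * i / h : ℤ)) := by
  have h1 : ∀ j ∈ Finset.Ioo 0 k, ((h * j / k : ℤ) : ℝ) * ((h * j / k : ℤ) + 1) =
      ∑ i ∈ Finset.Ioo 0 h, if i ≤ h * j / k then 2 * (i : ℝ) else 0 := by
    intro j hj
    rw [Finset.mem_Ioo] at hj
    have hlt : h * j / k < h := Int.ediv_lt_of_lt_mul hk (by nlinarith)
    have hnn : 0 ≤ h * j / k := Int.ediv_nonneg (by nlinarith) hk.le
    rw [← Finset.sum_filter]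
    have : (Finset.Ioo 0 h).filter (fun i => i ≤ h * j / k) = Finset.Ioo 0 (h * j / k + 1) := by
      ext i
      simp only [Finset.mem_filter, Finset.mem_Ioo]
      omega
    rw [this, ← Finset.mul_sum, sum_Ioo_cast (by omega)]
    push_cast
    ring
  rw [Finset.sum_congr rfl h1, Finset.sum_comm]
  refine Finset.sum_congr rfl fun i hi => ?_
  have hnd := not_dvd_mul_of_mem_Ioo hc.symm hi
  rw [Finset.mem_Ioo] at hi
  have hlt : k * i / h < k := Int.ediv_lt_of_lt_mul hh (by nlinarith)
  have hnn : 0 ≤ k * i / h := Int.ediv_nonneg (by nlinarith) hh.le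
  rw [← Finset.sum_filter]
  have : (Finset.Ioo 0 k).filter (fun j => i ≤ h * j / k) = Finset.Ioo (k * i / h) k := by
    ext j
    simp only [Finset.mem_filter, Finset.mem_Ioo]
    rw [Int.le_ediv_iff_mul_le hk]
    have hne : k * i ≠ j * h := fun he => hnd ⟨j, by rw [he]; ring⟩
    have : i * k ≤ h * j ↔ k * i / h < j := by
      rw [Int.ediv_lt_iff_lt_mul hh]
      constructor
      · intro hle
        exact lt_of_le_of_ne (by linarith) hne
      · intro hle
        linarith
    rw [this]
    constructor
    · rintro ⟨⟨h1, h2⟩, h3⟩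
      exact ⟨h3, h2⟩
    · rintro ⟨h1, h2⟩
      exact ⟨⟨by omega, h2⟩, h1⟩
  rw [this, Finset.sum_const, Int.card_Ioo, nsmul_eq_mul]
  have : ((k - k * i / h - 1).toNat : ℤ) = k - k * i / h - 1 := by omega
  have h2 := congrArg (Int.cast : ℤ → ℝ) this
  push_cast at h2
  rw [h2]
  ring

/-- Each Dedekind sum is affine in `G` or `G'`, the sums of `j ⌊hj/k⌋` and `i ⌊ki/h⌋`. Permuting the
squares of the fractional parts ties `G` to the sum of squared floors, and `sum_floor_mul_succ` ties
the latter to `G'`. -/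
lemma dedekindSum_reciprocity_of_pos {h k : ℤ} (hh : 0 < h) (hk : 0 < k) (hc : IsCoprime h k) :
    dedekindSum h k + dedekindSum k h =
      -1 / 4 + ((h : ℝ) ^ 2 + k ^ 2 + 1) / (12 * h * k) := by
  have expand : ∀ {h k : ℤ}, 0 < k → IsCoprime h k → dedekindSum h k =
      (h : ℝ) * (k - 1) * (2 * k - 1) / (6 * k) -
        (∑ j ∈ Finset.Ioo 0 k, (j : ℝ) * (h * j / k : ℤ)) / k - (k - 1) / 4 := by
    intro h k hk hc
    have hk' : (k : ℝ) ≠ 0 := by exact_mod_cast hk.ne'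
    have e1 := sum_Ioo_fract hk hc id
    simp only [id] at e1
    have e2 : dedekindSum h k = ∑ j ∈ Finset.Ioo 0 k,
        ((h / k ^ 2 : ℝ) * (j : ℝ) ^ 2 - (1 / k : ℝ) * (j * (h * j / k : ℤ)) - (1 / (2 * k) : ℝ) * j
          - (1 / 2) * ((h * j : ℝ) / k - (h * j / k : ℤ)) + 1 / 4) := by
      rw [dedekindSum_eq_sum_Ioo hk hc]
      refine Finset.sum_congr rfl fun j _ => ?_
      field_simp
      ring
    rw [e2, Finset.sum_add_distrib, Finset.sum_sub_distrib, Finset.sum_sub_distrib,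
      Finset.sum_sub_distrib, ← Finset.mul_sum, ← Finset.mul_sum, ← Finset.mul_sum,
      ← Finset.mul_sum, e1, ← Finset.sum_div, sum_Ioo_sq hk, sum_Ioo_cast hk, sum_Ioo_const hk]
    field_simp
    ring
  have hk' : (k : ℝ) ≠ 0 := by exact_mod_cast hk.ne'
  have hh' : (h : ℝ) ≠ 0 := by exact_mod_cast hh.ne'
  rw [expand hk hc, expand hh hc.symm]
  have e1 := sum_Ioo_fract hk hc id
  have e2 := sum_Ioo_fract hk hc (fun x => x ^ 2)
  simp only [id] at e1
  have e3 := sum_floor_mul_succ hh hk hc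
  set G := ∑ j ∈ Finset.Ioo 0 k, (j : ℝ) * (h * j / k : ℤ) with hG
  set G' := ∑ i ∈ Finset.Ioo 0 h, (i : ℝ) * (k * i / h : ℤ) with hG'
  set F := ∑ j ∈ Finset.Ioo 0 k, ((h * j / k : ℤ) : ℝ) with hF
  set F2 := ∑ j ∈ Finset.Ioo 0 k, ((h * j / k : ℤ) : ℝ) ^ 2 with hF2
  have e3' : F2 + F = 2 * (k - 1) * (h * (h - 1) / 2) - 2 * G' := by
    rw [← sum_Ioo_cast hh, hF2, hF, hG', ← Finset.sum_add_distrib, Finset.mul_sum, Finset.mul_sum,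
      ← Finset.sum_sub_distrib]
    refine Eq.trans (Finset.sum_congr rfl fun j _ => ?_)
      (e3.trans (Finset.sum_congr rfl fun j _ => ?_)) <;> ring
  have e1' : (h / k : ℝ) * (k * (k - 1) / 2) - F = k * (k - 1) / 2 / k := by
    rw [← sum_Ioo_cast hk, Finset.sum_div, ← e1, hF, Finset.mul_sum, ← Finset.sum_sub_distrib]
    refine Finset.sum_congr rfl fun j _ => ?_
    ring
  have e2' : (h ^ 2 / k ^ 2 : ℝ) * (k * (k - 1) * (2 * k - 1) / 6) - (2 * h / k : ℝ) * G + F2 =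
      k * (k - 1) * (2 * k - 1) / 6 / k ^ 2 := by
    have : k * (k - 1) * (2 * k - 1) / 6 / (k : ℝ) ^ 2 =
        ∑ j ∈ Finset.Ioo 0 k, ((j : ℝ) / k) ^ 2 := by
      rw [← sum_Ioo_sq hk, Finset.sum_div]
      refine Finset.sum_congr rfl fun j _ => ?_
      ring
    rw [this, ← e2, ← sum_Ioo_sq hk, hF2, hG, Finset.mul_sum, Finset.mul_sum,
      ← Finset.sum_sub_distrib, ← Finset.sum_add_distrib]
    refine Finset.sum_congr rfl fun j _ => ?_
    ring
  clear_value G G' F F2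
  have g1 : G' = (k - 1) * (h * (h - 1) / 2) - (F2 + F) / 2 := by linarith
  have g2 : F = (h / k : ℝ) * (k * (k - 1) / 2) - k * (k - 1) / 2 / k := by linarith
  have g3 : F2 = k * (k - 1) * (2 * k - 1) / 6 / k ^ 2 -
    (h ^ 2 / k ^ 2 : ℝ) * (k * (k - 1) * (2 * k - 1) / 6) + (2 * h / k : ℝ) * G := by linarith
  rw [g1, g2, g3]
  field_simp
  ring

/-- Both sides are odd in `h` and in `k` separately, which reduces everything to positive arguments.
All signs are needed because vertices lie on both sides of the reference line. -/
lemma dedekindSum_reciprocity {h k : ℤ} (hh : h ≠ 0) (hk : k ≠ 0) (hc : IsCoprime h k) :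
    dedekindSum h k + dedekindSum k h =
      -((h * k).sign : ℝ) / 4 + ((h : ℝ) ^ 2 + k ^ 2 + 1) / (12 * h * k) := by
  have hk' : (k : ℝ) ≠ 0 := by exact_mod_cast hk
  have hh' : (h : ℝ) ≠ 0 := by exact_mod_cast hh
  rcases lt_or_gt_of_ne hh with h1 | h1 <;> rcases lt_or_gt_of_ne hk with h2 | h2
  · have := dedekindSum_reciprocity_of_pos (h := -h) (k := -k) (by omega) (by omega)
      hc.neg_left.neg_right
    simp only [dedekindSum_neg_left, dedekindSum_neg_right, neg_neg] at this
    rw [this, Int.sign_eq_one_of_pos (mul_pos_of_neg_of_neg h1 h2)]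
    push_cast
    field_simp
  · have := dedekindSum_reciprocity_of_pos (h := -h) (k := k) (by omega) (by omega) hc.neg_left
    simp only [dedekindSum_neg_left, dedekindSum_neg_right] at this
    rw [Int.sign_eq_neg_one_of_neg (mul_neg_of_neg_of_pos h1 h2),
      show dedekindSum h k + dedekindSum k h = -(-dedekindSum h k + -dedekindSum k h) by ring, this]
    push_cast
    field_simp
    ring
  · have := dedekindSum_reciprocity_of_pos (h := h) (k := -k) (by omega) (by omega) hc.neg_right
    simp only [dedekindSum_neg_left, dedekindSum_neg_right] at this
    rw [Int.sign_eq_neg_one_of_neg (mul_neg_of_pos_of_neg h1 h2),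
      show dedekindSum h k + dedekindSum k h = -(-dedekindSum h k + -dedekindSum k h) by ring, this]
    push_cast
    field_simp
    ring
  · rw [dedekindSum_reciprocity_of_pos h1 h2 hc, Int.sign_eq_one_of_pos (mul_pos h1 h2)]
    push_cast
    ring

/-! ### The three-term law -/

lemma dedekindSum_of_isUnit (h : ℤ) {k : ℤ} (hk : IsUnit k) : dedekindSum h k = 0 := by
  rcases Int.isUnit_iff.1 hk with rfl | rfl
  · exact dedekindSum_one h
  · rw [dedekindSum_neg_right, dedekindSum_one, neg_zero]

/-- The three-term law for two vectors of determinant one. -/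
lemma dedekindSum_sub_of_det_eq_one {p q p' q' : ℤ} (hq : q ≠ 0) (hq' : q' ≠ 0)
    (hd : p * q' - q * p' = 1) :
    dedekindSum p' q' - dedekindSum p q =
      ((q * q').sign : ℝ) / 4 - ((q : ℝ) ^ 2 + q' ^ 2 + 1) / (12 * q * q') := by
  -- The determinant condition says that `p q' ≡ 1` mod `q` and `-p' q ≡ 1` mod `q'`; inverting both
  -- numerators leaves a reciprocal pair.
  have h1 : dedekindSum p q = dedekindSum q' q := dedekindSum_inv ⟨p', by linarith⟩
  have h2 : dedekindSum p' q' = -dedekindSum q q' := by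
    rw [← dedekindSum_neg_left]
    exact dedekindSum_inv ⟨-p, by linarith⟩
  have h3 := dedekindSum_reciprocity hq hq' ⟨-p', p, by linarith⟩
  rw [h1, h2]
  linear_combination -h3

/-- The three-term law when the first vector has determinant `±1` with the reference vector. -/
lemma dedekindSum_three_term_of_isUnit {p q p' q' k d : ℤ} (hw : IsCoprime p' q')
    (hq : IsUnit q) (hq' : q' ≠ 0) (hd : p * q' - q * p' = d) (hd0 : 0 < d)
    (h2 : d ∣ q' - k * q) :
    dedekindSum k d = dedekindSum p' q' - dedekindSum p q - ((q * q').sign : ℝ) / 4 +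
      ((q : ℝ) ^ 2 + q' ^ 2 + d ^ 2) / (12 * q * q' * d) := by
  rw [dedekindSum_of_isUnit p hq]
  have hd' : (d : ℝ) ≠ 0 := by exact_mod_cast hd0.ne'
  have hq'' : (q' : ℝ) ≠ 0 := by exact_mod_cast hq'
  have hcop : IsCoprime q' d := by
    rw [← hd, show p * q' - q * p' = -(q * p') + p * q' by ring]
    refine IsCoprime.add_mul_right_right ?_ p
    refine (IsCoprime.mul_right ?_ hw.symm).neg_right
    obtain ⟨c, hc⟩ := hq.exists_left_inv
    exact ⟨0, c, by rw [hc]; ring⟩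
  have h3 := dedekindSum_reciprocity hq' hd0.ne' hcop
  rw [Int.sign_mul, Int.sign_eq_one_of_pos hd0, mul_one] at h3
  rcases Int.isUnit_iff.1 hq with rfl | rfl
  · have e1 : dedekindSum k d = dedekindSum q' d :=
      dedekindSum_congr (by rw [← dvd_neg, show -(k - q') = q' - k * 1 by ring]; exact h2)
    have e2 : dedekindSum p' q' = -dedekindSum d q' := by
      rw [← dedekindSum_neg_left]
      exact dedekindSum_congr ⟨p, by linarith⟩
    rw [e1, e2, one_mul]
    push_cast
    rw [eq_sub_of_add_eq h3]
    field_simp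
    ring
  · have e1 : dedekindSum k d = -dedekindSum q' d := by
      rw [← dedekindSum_neg_left]
      exact dedekindSum_congr (by rw [show k - -q' = q' - k * -1 by ring]; exact h2)
    have e2 : dedekindSum p' q' = dedekindSum d q' := dedekindSum_congr ⟨-p, by linarith⟩
    rw [e1, e2, neg_one_mul, Int.sign_neg]
    push_cast
    rw [eq_sub_of_add_eq h3]
    field_simp
    ring

/-- If `q` and `x` have opposite signs, `q'` has the sign of `x`; otherwise the identity is
immediate. It makes the sign terms add up when a cone is subdivided. -/
lemma sign_mul_add_of_eq {q x q' d k : ℤ} (hq : q ≠ 0) (hx : x ≠ 0) (hd : 0 < d) (hk : 0 < k)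
    (h : q' = d * x - k * q) :
    (q * q').sign + 1 = (q * x).sign + (x * q').sign := by
  simp only [Int.sign_mul]
  rcases lt_or_gt_of_ne hq with h1 | h1 <;> rcases lt_or_gt_of_ne hx with h2 | h2
  · simp [Int.sign_eq_neg_one_of_neg h1, Int.sign_eq_neg_one_of_neg h2]; ring
  · rw [Int.sign_eq_neg_one_of_neg h1, Int.sign_eq_one_of_pos h2,
      Int.sign_eq_one_of_pos (by nlinarith)]; ring
  · rw [Int.sign_eq_neg_one_of_neg h2, Int.sign_eq_one_of_pos h1,
      Int.sign_eq_neg_one_of_neg (by nlinarith)]; ring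
  · rw [Int.sign_eq_one_of_pos h1, Int.sign_eq_one_of_pos h2]; ring

/-- The three-term law for Dedekind sums, for the vectors `(1, 0)`, `(p, q)` and `(p', q')`. -/
theorem dedekindSum_three_term {p q p' q' k d : ℤ} (hw : IsCoprime p' q')
    (hq : q ≠ 0) (hq' : q' ≠ 0) (hd : p * q' - q * p' = d) (hd0 : 0 < d)
    (h1 : d ∣ p' - k * p) (h2 : d ∣ q' - k * q) :
    dedekindSum k d = dedekindSum p' q' - dedekindSum p q - ((q * q').sign : ℝ) / 4 +
      ((q : ℝ) ^ 2 + q' ^ 2 + d ^ 2) / (12 * q * q' * d) := by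
  induction hn : d.toNat using Nat.strong_induction_on generalizing p q k d with
  | _ n ih =>
  by_cases hd1 : d = 1
  · have h3 := dedekindSum_sub_of_det_eq_one hq hq' (by rw [hd, hd1])
    subst hd1
    rw [dedekindSum_one, h3]
    push_cast
    ring
  have hk0 : k % d ≠ 0 := by
    intro hk
    have hdk : d ∣ k := Int.dvd_of_emod_eq_zero hk
    have e1 : d ∣ p' := by
      have := dvd_add h1 (hdk.mul_right p)
      rwa [sub_add_cancel] at this
    have e2 : d ∣ q' := by
      have := dvd_add h2 (hdk.mul_right q)
      rwa [sub_add_cancel] at this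
    have := Int.isUnit_iff.1 (hw.isUnit_of_dvd' e1 e2)
    omega
  have hklt := Int.emod_lt_of_pos k hd0
  have hknn := Int.emod_nonneg k hd0.ne'
  -- With `c ≡ -k` and `0 < c < d`, the vector `(x, y) = ((p', q') + c (p, q)) / d` is integral. It
  -- splits the cone, as in a Hirzebruch–Jung resolution, into one of determinant 1 and one of the
  -- smaller determinant `c`.
  obtain ⟨c, hc⟩ : ∃ c, c = d - k % d := ⟨_, rfl⟩
  have hkc : d ∣ k + c := ⟨k / d + 1, by rw [hc]; linarith [Int.emod_add_mul_ediv k d]⟩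
  obtain ⟨x, hx⟩ : d ∣ p' + c * p := by
    have := dvd_add h1 (hkc.mul_right p)
    rwa [show p' - k * p + (k + c) * p = p' + c * p by ring] at this
  obtain ⟨y, hy⟩ : d ∣ q' + c * q := by
    have := dvd_add h2 (hkc.mul_right q)
    rwa [show q' - k * q + (k + c) * q = q' + c * q by ring] at this
  have hdet : p * y - q * x = 1 := by
    have : d * (p * y - q * x) = d * 1 := by linear_combination hd - p * hy + q * hx
    exact mul_left_cancel₀ hd0.ne' this
  -- If the new vector is parallel to the reference vector, the induction hypothesis does not apply;
  -- but then `-q x = 1`, so `q` is a unit.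
  by_cases hy0 : y = 0
  · refine dedekindSum_three_term_of_isUnit hw ?_ hq' hd hd0 h2
    refine IsUnit.of_mul_eq_one (-x) ?_
    rw [hy0] at hdet
    linarith
  have hdet' : x * q' - y * p' = c := by linear_combination x * hy - y * hx + c * hdet
  have hc0 : 0 < c := by omega
  have key := ih c.toNat (by omega) (p := x) (q := y) (k := d) (d := c)
    hy0 hdet' hc0 ⟨-p, by linarith⟩ ⟨-q, by linarith⟩ rfl
  have base := dedekindSum_sub_of_det_eq_one hq hy0 hdet
  have e1 : dedekindSum k d = -dedekindSum c d := by
    rw [← dedekindSum_neg_left]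
    exact dedekindSum_congr (by rwa [sub_neg_eq_add])
  have hcd : IsCoprime c d := by
    obtain ⟨a, b, hab⟩ := hw
    rw [eq_sub_of_add_eq hx, eq_sub_of_add_eq hy] at hab
    exact ⟨-(a * p + b * q), a * x + b * y, by linarith⟩
  have hrec := dedekindSum_reciprocity hc0.ne' hd0.ne' hcd
  rw [Int.sign_eq_one_of_pos (mul_pos hc0 hd0)] at hrec
  have hsign := sign_mul_add_of_eq hq hy0 hd0 hc0 (eq_sub_of_add_eq hy)
  have hsign' : ((q * q').sign : ℝ) + 1 = (q * y).sign + (y * q').sign := by exact_mod_cast hsign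
  have hqy : (q' : ℝ) = d * y - c * q := by exact_mod_cast eq_sub_of_add_eq hy
  have n1 : (q : ℝ) ≠ 0 := by exact_mod_cast hq
  have n2 : (q' : ℝ) ≠ 0 := by exact_mod_cast hq'
  have n3 : (y : ℝ) ≠ 0 := by exact_mod_cast hy0
  have n4 : (c : ℝ) ≠ 0 := by exact_mod_cast hc0.ne'
  have n5 : (d : ℝ) ≠ 0 := by exact_mod_cast hd0.ne'
  have rat : ((q : ℝ) ^ 2 + q' ^ 2 + d ^ 2) / (12 * q * q' * d) =
      ((y : ℝ) ^ 2 + q' ^ 2 + c ^ 2) / (12 * y * q' * c) +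
      ((q : ℝ) ^ 2 + y ^ 2 + 1) / (12 * q * y) - ((c : ℝ) ^ 2 + d ^ 2 + 1) / (12 * c * d) := by
    field_simp
    rw [hqy]
    ring
  rw [e1, rat]
  push_cast at hrec
  linear_combination key - base - hrec + hsign' / 4

/-! ### The quadratic sum over a cone as a Dedekind sum -/

/-- The sum of `(1 - x - y)²` over the lattice points `x • u + y • v` of an open parallelogram
spanned by primitive vectors, in terms of Dedekind sums. -/
lemma sum_fract_sub_sq {h d : ℤ} (hd : 0 < d) (hc : IsCoprime h d) :
    ∑ j ∈ Finset.Ioo 0 d, (Int.fract ((h * j : ℝ) / d) - j / d) ^ 2 =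
      ((d : ℝ) - 3 + 2 / d) / 6 - 2 * dedekindSum h d := by
  have hd' : (d : ℝ) ≠ 0 := by exact_mod_cast hd.ne'
  have e0 : ∀ j : ℤ, Int.fract ((h * j : ℝ) / d) = (h * j : ℝ) / d - (h * j / d : ℤ) := by
    intro j
    exact_mod_cast fract_cast_div (h * j) hd
  have e2 := sum_Ioo_fract hd hc (fun x => (x - 1 / 2) ^ 2)
  have e3 : ∑ j ∈ Finset.Ioo 0 d, ((j : ℝ) / d - 1 / 2) ^ 2 = ((d : ℝ) - 3 + 2 / d) / 12 := by
    have : ∀ j ∈ Finset.Ioo 0 d, ((j : ℝ) / d - 1 / 2) ^ 2 =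
        (1 / d ^ 2 : ℝ) * (j : ℝ) ^ 2 - (1 / d : ℝ) * j + 1 / 4 := by
      intro j _
      field_simp
      ring
    rw [Finset.sum_congr rfl this, Finset.sum_add_distrib, Finset.sum_sub_distrib,
      ← Finset.mul_sum, ← Finset.mul_sum, sum_Ioo_sq hd, sum_Ioo_cast hd, sum_Ioo_const hd]
    field_simp
    ring
  -- Centre both terms at `1/2` and expand the square: the two square sums agree by permutation, and
  -- the cross term is the Dedekind sum.
  have e4 : ∑ j ∈ Finset.Ioo 0 d, (Int.fract ((h * j : ℝ) / d) - j / d) ^ 2 =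
      ∑ j ∈ Finset.Ioo 0 d, ((((h * j : ℝ) / d - (h * j / d : ℤ)) - 1 / 2) ^ 2 +
        ((j : ℝ) / d - 1 / 2) ^ 2 -
        2 * (((j : ℝ) / d - 1 / 2) * (h * j / d - (h * j / d : ℤ) - 1 / 2))) := by
    refine Finset.sum_congr rfl fun j _ => ?_
    rw [e0]
    ring
  rw [e4, Finset.sum_sub_distrib, Finset.sum_add_distrib, ← Finset.mul_sum,
    ← dedekindSum_eq_sum_Ioo hd hc, e2, e3]
  ring

/-- The reflection `j ↦ d - j` changes the sign of `{hj/d} - j/d`, so the positive and negative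
terms have equal sums of squares; ties contribute 0. -/
lemma sum_fract_sub_sq_filter {h d : ℤ} (hd : 0 < d) (hc : IsCoprime h d) :
    2 * ∑ j ∈ (Finset.Ioo 0 d).filter (fun j : ℤ => (j : ℝ) / d ≤ Int.fract ((h * j : ℝ) / d)),
      (Int.fract ((h * j : ℝ) / d) - j / d) ^ 2 =
    ∑ j ∈ Finset.Ioo 0 d, (Int.fract ((h * j : ℝ) / d) - j / d) ^ 2 := by
  have hd' : (d : ℝ) ≠ 0 := by exact_mod_cast hd.ne'
  rw [two_mul, ← Finset.sum_filter_add_sum_filter_not (Finset.Ioo 0 d)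
    (fun j : ℤ => (j : ℝ) / d ≤ Int.fract ((h * j : ℝ) / d))]
  congr 1
  have refl : ∀ j ∈ Finset.Ioo 0 d, Int.fract ((h * (d - j : ℤ) : ℝ) / d) - (d - j : ℤ) / d =
      -(Int.fract ((h * j : ℝ) / d) - j / d) := by
    intro j hj
    have hnd : Int.fract ((h * j : ℝ) / d) ≠ 0 := by
      have := mt (fract_cast_div_eq_zero_iff (h * j) hd).1 (not_dvd_mul_of_mem_Ioo hc hj)
      exact_mod_cast this
    have : (h * (d - j : ℤ) : ℝ) / d = -(h * j / d) + h := by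
      push_cast
      field_simp
      ring
    rw [this, Int.fract_add_intCast, Int.fract_neg hnd]
    push_cast
    field_simp
    ring
  have hsum : ∑ j ∈ (Finset.Ioo 0 d).filter
      (fun j : ℤ => (j : ℝ) / d ≤ Int.fract ((h * j : ℝ) / d)),
        (Int.fract ((h * j : ℝ) / d) - j / d) ^ 2 =
      ∑ j ∈ (Finset.Ioo 0 d).filter (fun j : ℤ => Int.fract ((h * j : ℝ) / d) ≤ (j : ℝ) / d),
        (Int.fract ((h * j : ℝ) / d) - j / d) ^ 2 := by
    have hm : ∀ j ∈ Finset.Ioo 0 d, d - j ∈ Finset.Ioo 0 d := by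
      intro j hj
      rw [Finset.mem_Ioo] at hj ⊢
      omega
    refine Finset.sum_nbij' (fun j => d - j) (fun j => d - j) ?_ ?_ ?_ ?_ ?_
    · intro j hj
      rw [Finset.mem_filter] at hj ⊢
      exact ⟨hm j hj.1, by linarith [refl j hj.1, hj.2]⟩
    · intro j hj
      rw [Finset.mem_filter] at hj ⊢
      exact ⟨hm j hj.1, by linarith [refl j hj.1, hj.2]⟩
    · intro j _
      ring
    · intro j _
      ring
    · intro j hj
      rw [refl j (Finset.mem_filter.1 hj).1, neg_sq]
  rw [hsum]
  symm
  apply Finset.sum_subset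
  · intro j hj
    rw [Finset.mem_filter] at hj ⊢
    exact ⟨hj.1, (not_le.1 hj.2).le⟩
  · intro j hj hj2
    rw [Finset.mem_filter] at hj hj2
    have : Int.fract ((h * j : ℝ) / d) = j / d :=
      le_antisymm hj.2 (by by_contra hlt; exact hj2 ⟨hj.1, hlt⟩)
    rw [this, sub_self, zero_pow two_ne_zero]

/-! ### Plane polygons around the origin: edges and their cones -/

section Polygon

variable {E : Type*} [AddCommGroup E] [Module ℝ E] (b : Basis (Fin 2) ℝ E)

/-- The determinant of two vectors of a plane with respect to a basis. -/
noncomputable def cross : E →ₗ[ℝ] E →ₗ[ℝ] ℝ :=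
  LinearMap.mk₂ ℝ (fun x y => b.coord 0 x * b.coord 1 y - b.coord 1 x * b.coord 0 y)
    (fun x y z => by simp only [map_add]; ring)
    (fun c x y => by simp only [map_smul, smul_eq_mul]; ring)
    (fun x y z => by simp only [map_add]; ring)
    (fun c x y => by simp only [map_smul, smul_eq_mul]; ring)

lemma cross_apply (x y : E) :
    cross b x y = b.coord 0 x * b.coord 1 y - b.coord 1 x * b.coord 0 y := rfl

lemma cross_self (x : E) : cross b x x = 0 := by
  rw [cross_apply]; ring

lemma cross_swap (x y : E) : cross b x y = -cross b y x := by
  rw [cross_apply, cross_apply]; ring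

/-- Cramer's rule without division. -/
lemma cross_smul_eq (u v x : E) :
    cross b u v • x = cross b x v • u + cross b u x • v := by
  refine b.ext_elem fun i => ?_
  simp only [map_add, map_smul, Finsupp.add_apply, Finsupp.smul_apply, smul_eq_mul, cross_apply,
    Basis.coord_apply]
  fin_cases i <;> simp <;> ring

lemma eq_of_cross_pos {u v : E} (h : 0 < cross b u v) (x : E) :
    x = (cross b x v / cross b u v) • u + (cross b u x / cross b u v) • v := by
  have h2 := congrArg (fun z => (cross b u v)⁻¹ • z) (cross_smul_eq b u v x)
  simp only [smul_add, smul_smul] at h2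
  rw [inv_mul_cancel₀ h.ne', one_smul] at h2
  rw [div_eq_inv_mul, div_eq_inv_mul]
  exact h2

/-- `P` is a convex polygon around the origin with set of vertices `V`. -/
structure IsPolygon (P : Set E) (V : Finset E) : Prop where
  eq_hull : P = convexHull ℝ (V : Set E)
  zero_mem : (0 : E) ∈ P
  exists_cross_pos : ∀ x : E, x ≠ 0 → ∃ v ∈ V, 0 < cross b x v
  extreme : ∀ u ∈ V, ∀ x ∈ P, ∀ y ∈ P, u ∈ openSegment ℝ x y → x = u
  ne_zero : ∀ u ∈ V, u ≠ 0

/-- The positively oriented edges of a polygon with vertices `V`. -/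
def IsEdge (V : Finset E) (u v : E) : Prop :=
  u ∈ V ∧ v ∈ V ∧ 0 < cross b u v ∧ ∀ x ∈ V, cross b u x + cross b x v ≤ cross b u v

/-- The linear form with value `1` at `u` and at `v`. -/
noncomputable def edgeForm (u v : E) : E →ₗ[ℝ] ℝ :=
  (cross b u v)⁻¹ • (cross b u + (cross b).flip v)

lemma edgeForm_apply (u v x : E) :
    edgeForm b u v x = (cross b u x + cross b x v) / cross b u v := by
  rw [div_eq_inv_mul]
  rfl

lemma edgeForm_left {u v : E} (h : 0 < cross b u v) : edgeForm b u v u = 1 := by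
  rw [edgeForm_apply, cross_self, zero_add, div_self h.ne']

lemma edgeForm_right {u v : E} (h : 0 < cross b u v) : edgeForm b u v v = 1 := by
  rw [edgeForm_apply, cross_self, add_zero, div_self h.ne']

/-- The closed cone spanned by a positively oriented pair of vectors. -/
def InCone (u v x : E) : Prop := 0 ≤ cross b u x ∧ 0 ≤ cross b x v

variable {b} {P : Set E} {V : Finset E}

namespace IsEdge

variable {u v : E}

lemma left_mem (h : IsEdge b V u v) : u ∈ V := h.1
lemma right_mem (h : IsEdge b V u v) : v ∈ V := h.2.1
lemma pos (h : IsEdge b V u v) : 0 < cross b u v := h.2.2.1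

lemma edgeForm_le (h : IsEdge b V u v) {x : E} (hx : x ∈ V) : edgeForm b u v x ≤ 1 := by
  rw [edgeForm_apply, div_le_one h.pos]
  exact h.2.2.2 x hx

lemma edgeForm_eq_one_left (h : IsEdge b V u v) : edgeForm b u v u = 1 := edgeForm_left b h.pos
lemma edgeForm_eq_one_right (h : IsEdge b V u v) : edgeForm b u v v = 1 := edgeForm_right b h.pos

end IsEdge

namespace IsPolygon

lemma convex (hP : IsPolygon b P V) : Convex ℝ P := by
  rw [hP.eq_hull]; exact convex_convexHull ℝ _

lemma vertex_mem (hP : IsPolygon b P V) {u : E} (hu : u ∈ V) : u ∈ P := by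
  rw [hP.eq_hull]; exact subset_convexHull ℝ _ hu

lemma le_one_of_smul_mem (hP : IsPolygon b P V) {u : E} (hu : u ∈ V) {c : ℝ} (h : c • u ∈ P) :
    c ≤ 1 := by
  by_contra hc
  push Not at hc
  have hc0 : 0 < c := by linarith
  refine hP.ne_zero u hu (hP.extreme u hu 0 hP.zero_mem (c • u) h ?_).symm
  refine ⟨1 - c⁻¹, c⁻¹, ?_, inv_pos.2 hc0, by ring, ?_⟩
  · have := inv_lt_one_of_one_lt₀ hc
    linarith
  · rw [smul_zero, zero_add, smul_smul, inv_mul_cancel₀ hc0.ne', one_smul]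

/-- Let `f` be the coordinate along `u` in a basis `u, w`. Among the vertices on the positive side
of `u`, the neighbour maximizes the slope `(f - 1) / cross b u ·` seen from `u`. Vertices on the
other side cannot violate the edge inequality, because `u` is extreme. -/
lemma exists_isEdge_left (hP : IsPolygon b P V) {u : E} (hu : u ∈ V) : ∃ v, IsEdge b V u v := by
  classical
  obtain ⟨w, hw, hw0⟩ := hP.exists_cross_pos u (hP.ne_zero u hu)
  set f : E → ℝ := fun x => cross b x w / cross b u w with hf
  have hcross : ∀ x y, cross b x y = f x * cross b u y - f y * cross b u x := by
    intro x y
    have h1 := congrArg (fun z => cross b z y) (cross_smul_eq b u w x)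
    simp only [map_add, map_smul, LinearMap.add_apply, LinearMap.smul_apply, smul_eq_mul] at h1
    have h2 := cross_swap b w y
    simp only [hf]
    field_simp
    linear_combination h1 + cross b u x * h2
  have hzero : ∀ x, cross b u x = 0 → x = f x • u := by
    intro x hx
    have h1 := eq_of_cross_pos b hw0 x
    rwa [hx, zero_div, zero_smul, add_zero] at h1
  obtain ⟨v, hv, hmax⟩ := Finset.exists_max_image (V.filter fun v => 0 < cross b u v)
    (fun v => (f v - 1) / cross b u v) ⟨w, Finset.mem_filter.2 ⟨hw, hw0⟩⟩
  rw [Finset.mem_filter] at hv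
  obtain ⟨hvV, hv0⟩ := hv
  refine ⟨v, hu, hvV, hv0, fun x hx => ?_⟩
  rw [hcross x v]
  suffices h : (f x - 1) * cross b u v ≤ (f v - 1) * cross b u x by linarith
  rcases lt_trichotomy (cross b u x) 0 with hx0 | hx0 | hx0
  · by_contra hcon
    push Not at hcon
    have hden : 0 < cross b u v - cross b u x := by linarith
    -- The point where the segment from `x` to `v` meets the line through `u`; a violated inequality
    -- would put it beyond `u`.
    set z := (cross b u v / (cross b u v - cross b u x)) • x +
      (-cross b u x / (cross b u v - cross b u x)) • v with hz
    have hzP : z ∈ P := hP.convex (hP.vertex_mem hx) (hP.vertex_mem hvV)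
      (div_nonneg hv0.le hden.le) (div_nonneg (by linarith) hden.le)
      (by field_simp; ring)
    have hz0 : cross b u z = 0 := by
      simp only [hz, map_add, map_smul, smul_eq_mul]
      field_simp
      ring
    have hfz : f z = (cross b u v * f x - cross b u x * f v) / (cross b u v - cross b u x) := by
      simp only [hf, hz, map_add, map_smul, smul_eq_mul, LinearMap.add_apply,
        LinearMap.smul_apply]
      field_simp
      ring
    rw [hzero z hz0] at hzP
    have hle := hP.le_one_of_smul_mem hu hzP
    rw [hfz, div_le_one hden] at hle
    linarith
  · have h1 := hzero x hx0
    have h2 : f x • u ∈ P := h1 ▸ hP.vertex_mem hx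
    have h3 := hP.le_one_of_smul_mem hu h2
    rw [hx0, mul_zero]
    exact mul_nonpos_of_nonpos_of_nonneg (by linarith) hv0.le
  · have h1 := hmax x (Finset.mem_filter.2 ⟨hx, hx0⟩)
    rwa [div_le_div_iff₀ hx0 hv0] at h1

/-- Here `z = α u + β v` with `α + β = 1`. According to the signs, one of `u`, `v`, `z` lies
strictly between the other two, against extremality, unless `z` is an endpoint. -/
lemma eq_or_eq_of_edgeForm_eq_one (hP : IsPolygon b P V) {u v z : E} (h : IsEdge b V u v)
    (hz : z ∈ V) (hz1 : edgeForm b u v z = 1) : z = u ∨ z = v := by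
  have hpos := h.pos
  have hzeq := eq_of_cross_pos b hpos z
  rw [edgeForm_apply] at hz1
  set α := cross b z v / cross b u v with hα
  set β := cross b u z / cross b u v with hβ
  have hsum : α + β = 1 := by rw [← hz1, hα, hβ]; ring
  rcases lt_trichotomy α 0 with ha | ha | ha
  · right
    have hb : 0 < β := by linarith
    refine hP.extreme v h.right_mem z (hP.vertex_mem hz) u (hP.vertex_mem h.left_mem)
      ⟨1 / β, -α / β, by positivity, div_pos (by linarith) hb, ?_, ?_⟩
    · field_simp; linarith
    · conv_lhs => rw [hzeq]
      rw [smul_add, smul_smul, smul_smul, add_right_comm, ← add_smul, one_div,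
        inv_mul_cancel₀ hb.ne', one_smul, show β⁻¹ * α + -α / β = 0 by field_simp; ring, zero_smul,
        zero_add]
  · right
    rw [hzeq, ha, zero_smul, zero_add, show β = 1 by linarith, one_smul]
  · rcases lt_trichotomy β 0 with hb | hb | hb
    · left
      refine hP.extreme u h.left_mem z (hP.vertex_mem hz) v (hP.vertex_mem h.right_mem)
        ⟨1 / α, -β / α, by positivity, div_pos (by linarith) ha, ?_, ?_⟩
      · field_simp; linarith
      · conv_lhs => rw [hzeq]
        rw [smul_add, smul_smul, smul_smul, add_assoc, ← add_smul, one_div,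
          inv_mul_cancel₀ ha.ne', one_smul, show α⁻¹ * β + -β / α = 0 by field_simp; ring,
          zero_smul, add_zero]
    · left
      rw [hzeq, hb, zero_smul, add_zero, show α = 1 by linarith, one_smul]
    · left
      exact (hP.extreme z hz u (hP.vertex_mem h.left_mem) v (hP.vertex_mem h.right_mem)
        ⟨α, β, ha, hb, hsum, hzeq.symm⟩).symm

lemma right_unique (hP : IsPolygon b P V) {u v v' : E} (h : IsEdge b V u v)
    (h' : IsEdge b V u v') : v = v' := by
  have h1 := h.2.2.2 v' h'.right_mem
  have h2 := h'.2.2.2 v h.right_mem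
  have h3 := cross_swap b v v'
  have : edgeForm b u v v' = 1 := by
    rw [edgeForm_apply, div_eq_one_iff_eq h.pos.ne']
    linarith
  rcases hP.eq_or_eq_of_edgeForm_eq_one h h'.right_mem this with rfl | rfl
  · have := h'.pos
    rw [cross_self] at this
    exact absurd this (lt_irrefl 0)
  · rfl

lemma left_unique (hP : IsPolygon b P V) {u u' v : E} (h : IsEdge b V u v)
    (h' : IsEdge b V u' v) : u = u' := by
  have h1 := h.2.2.2 u' h'.left_mem
  have h2 := h'.2.2.2 u h.left_mem
  have h3 := cross_swap b u u'
  have : edgeForm b u v u' = 1 := by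
    rw [edgeForm_apply, div_eq_one_iff_eq h.pos.ne']
    linarith
  rcases hP.eq_or_eq_of_edgeForm_eq_one h h'.left_mem this with rfl | rfl
  · rfl
  · have := h'.pos
    rw [cross_self] at this
    exact absurd this (lt_irrefl 0)

lemma exists_next (hP : IsPolygon b P V) : ∃ next : E → E, ∀ u ∈ V, IsEdge b V u (next u) := by
  classical
  choose! f hf using fun (u : E) (hu : u ∈ V) => hP.exists_isEdge_left hu
  exact ⟨f, hf⟩

/-- The successor map on the finite set `V` is injective, hence surjective. -/
lemma exists_isEdge_right (hP : IsPolygon b P V) {v : E} (hv : v ∈ V) : ∃ u, IsEdge b V u v := by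
  obtain ⟨next, hnext⟩ := hP.exists_next
  have hsurj := Finset.surj_on_of_inj_on_of_card_le (s := V) (t := V) (fun u _ => next u)
    (fun u hu => (hnext u hu).right_mem)
    (fun u w hu hw h => hP.left_unique (v := next u) (hnext u hu) (by
      rw [h]; exact hnext w hw)) le_rfl
  obtain ⟨u, hu, rfl⟩ := hsurj v hv
  exact ⟨u, hnext u hu⟩

lemma edgeForm_next_lt (hP : IsPolygon b P V) {u v w : E} (h : IsEdge b V u v)
    (h' : IsEdge b V v w) : edgeForm b u v w < 1 := by
  refine lt_of_le_of_ne (h.edgeForm_le h'.right_mem) fun heq => ?_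
  have h1 := h.pos
  have h2 := h'.pos
  rcases hP.eq_or_eq_of_edgeForm_eq_one h h'.right_mem heq with rfl | rfl
  · rw [cross_swap] at h1
    linarith
  · rw [cross_self] at h2
    exact lt_irrefl _ h2

lemma edgeForm_prev_lt (hP : IsPolygon b P V) {t u v : E} (h : IsEdge b V t u)
    (h' : IsEdge b V u v) : edgeForm b u v t < 1 := by
  refine lt_of_le_of_ne (h'.edgeForm_le h.left_mem) fun heq => ?_
  have h1 := h.pos
  have h2 := h'.pos
  rcases hP.eq_or_eq_of_edgeForm_eq_one h' h.left_mem heq with rfl | rfl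
  · rw [cross_self] at h1
    exact lt_irrefl _ h1
  · rw [cross_swap] at h1
    linarith

end IsPolygon

lemma cross_mul_map (f : E →ₗ[ℝ] ℝ) (u v x : E) :
    cross b u v * f x = cross b x v * f u + cross b u x * f v := by
  have := congrArg f (cross_smul_eq b u v x)
  simpa only [map_add, map_smul, smul_eq_mul] using this

/-- A point of the cone is a nonnegative combination of `u` and `v`, where the cone's own form is 1
and every other edge form is at most 1. So the cone of an edge is where its form is largest, which
replaces all arguments about angular order. -/
lemma IsEdge.edgeForm_le_of_inCone {u v u' v' x : E} (h : IsEdge b V u v)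
    (h' : IsEdge b V u' v') (hx : InCone b u v x) :
    edgeForm b u' v' x ≤ edgeForm b u v x := by
  rw [edgeForm_apply b u v, le_div_iff₀ h.pos, mul_comm, cross_mul_map]
  have h1 := mul_le_mul_of_nonneg_left (h'.edgeForm_le h.left_mem) hx.2
  have h2 := mul_le_mul_of_nonneg_left (h'.edgeForm_le h.right_mem) hx.1
  linarith

namespace IsPolygon

/-- Comparison with the preceding and the following edge suffices: the difference of two adjacent
edge forms vanishes on the ray through their common vertex, and its sign decides the side. -/
lemma inCone_of_forall_le (hP : IsPolygon b P V) {u v x : E} (h : IsEdge b V u v)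
    (hx : ∀ u' v', IsEdge b V u' v' → edgeForm b u' v' x ≤ edgeForm b u v x) :
    InCone b u v x := by
  constructor
  · obtain ⟨t, ht⟩ := hP.exists_isEdge_right h.left_mem
    have h1 := hx t u ht
    have h2 := hP.edgeForm_prev_lt ht h
    have e1 := cross_mul_map (b := b) (edgeForm b u v) t u x
    have e2 := cross_mul_map (b := b) (edgeForm b t u) t u x
    rw [h.edgeForm_eq_one_left] at e1
    rw [ht.edgeForm_eq_one_left, ht.edgeForm_eq_one_right] at e2
    have h3 := mul_le_mul_of_nonneg_left h1 ht.pos.le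
    have h4 : cross b x u * (1 - edgeForm b u v t) ≤ 0 := by linarith
    have h5 : cross b x u ≤ 0 := nonpos_of_mul_nonpos_left h4 (by linarith)
    rw [cross_swap]
    linarith
  · obtain ⟨w, hw⟩ := hP.exists_isEdge_left h.right_mem
    have h1 := hx v w hw
    have h2 := hP.edgeForm_next_lt h hw
    have e1 := cross_mul_map (b := b) (edgeForm b u v) v w x
    have e2 := cross_mul_map (b := b) (edgeForm b v w) v w x
    rw [h.edgeForm_eq_one_right] at e1
    rw [hw.edgeForm_eq_one_left, hw.edgeForm_eq_one_right] at e2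
    have h3 := mul_le_mul_of_nonneg_left h1 hw.pos.le
    have h4 : cross b v x * (1 - edgeForm b u v w) ≤ 0 := by linarith
    have h5 : cross b v x ≤ 0 := nonpos_of_mul_nonpos_left h4 (by linarith)
    rw [cross_swap]
    linarith

end IsPolygon

open Classical in
/-- The finite set of positively oriented edges. -/
noncomputable def edges (b : Basis (Fin 2) ℝ E) (V : Finset E) : Finset (E × E) :=
  (V ×ˢ V).filter fun σ => IsEdge b V σ.1 σ.2

lemma mem_edges {σ : E × E} : σ ∈ edges b V ↔ IsEdge b V σ.1 σ.2 := by
  simp only [edges, Finset.mem_filter, Finset.mem_product, and_iff_right_iff_imp]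
  exact fun h => ⟨h.left_mem, h.right_mem⟩

namespace IsPolygon

lemma edges_nonempty [Nontrivial E] (hP : IsPolygon b P V) : (edges b V).Nonempty := by
  obtain ⟨x, hx⟩ := exists_ne (0 : E)
  obtain ⟨u, hu, -⟩ := hP.exists_cross_pos x hx
  obtain ⟨v, hv⟩ := hP.exists_isEdge_left hu
  exact ⟨(u, v), mem_edges.2 hv⟩

lemma exists_inCone [Nontrivial E] (hP : IsPolygon b P V) (x : E) :
    ∃ u v, IsEdge b V u v ∧ InCone b u v x := by
  obtain ⟨σ, hσ, hmax⟩ := Finset.exists_max_image (edges b V) (fun σ => edgeForm b σ.1 σ.2 x)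
    hP.edges_nonempty
  exact ⟨σ.1, σ.2, mem_edges.1 hσ, hP.inCone_of_forall_le (mem_edges.1 hσ)
    fun u' v' h => hmax (u', v') (mem_edges.2 h)⟩

/-- At a point with both coefficients positive, the other form can reach the maximum only if it
equals 1 at both `u` and `v`. -/
lemma eq_of_inCone_of_pos (hP : IsPolygon b P V) {u v u' v' x : E} (h : IsEdge b V u v)
    (h' : IsEdge b V u' v') (h1 : 0 < cross b u x) (h2 : 0 < cross b x v)
    (hx : InCone b u' v' x) : u = u' ∧ v = v' := by
  have hle := h'.edgeForm_le_of_inCone h hx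
  have e1 := cross_mul_map (b := b) (edgeForm b u v) u v x
  have e2 := cross_mul_map (b := b) (edgeForm b u' v') u v x
  rw [h.edgeForm_eq_one_left, h.edgeForm_eq_one_right] at e1
  have hu := h'.edgeForm_le h.left_mem
  have hv := h'.edgeForm_le h.right_mem
  have h3 := mul_le_mul_of_nonneg_left hle h.pos.le
  have hu1 : edgeForm b u' v' u = 1 := by
    refine le_antisymm hu ?_
    by_contra hlt
    push Not at hlt
    nlinarith [mul_lt_mul_of_pos_left hlt h2, mul_le_mul_of_nonneg_left hv h1.le]
  have hv1 : edgeForm b u' v' v = 1 := by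
    refine le_antisymm hv ?_
    by_contra hlt
    push Not at hlt
    nlinarith [mul_lt_mul_of_pos_left hlt h1, mul_le_mul_of_nonneg_left hu h2.le]
  have hpos := h.pos
  have hpos' := h'.pos
  rcases hP.eq_or_eq_of_edgeForm_eq_one h' h.left_mem hu1 with rfl | rfl <;>
    rcases hP.eq_or_eq_of_edgeForm_eq_one h' h.right_mem hv1 with rfl | rfl
  · rw [cross_self] at hpos; exact absurd hpos (lt_irrefl 0)
  · exact ⟨rfl, rfl⟩
  · rw [cross_swap] at hpos; linarith
  · rw [cross_self] at hpos; exact absurd hpos (lt_irrefl 0)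

lemma edgeForm_le_of_mem (hP : IsPolygon b P V) {u v x : E} (h : IsEdge b V u v) (hx : x ∈ P) :
    edgeForm b u v x ≤ 1 := by
  rw [hP.eq_hull] at hx
  have : convexHull ℝ (V : Set E) ⊆ {x | edgeForm b u v x ≤ 1} :=
    convexHull_min (fun z hz => h.edgeForm_le hz) (convex_halfSpace_le (edgeForm b u v).isLinear 1)
  exact this hx

lemma mem_of_inCone (hP : IsPolygon b P V) {u v x : E} (h : IsEdge b V u v)
    (hx : InCone b u v x) (hx1 : edgeForm b u v x ≤ 1) : x ∈ P := by
  rw [eq_of_cross_pos b h.pos x]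
  rw [edgeForm_apply, add_div] at hx1
  have ha : 0 ≤ cross b x v / cross b u v := div_nonneg hx.2 h.pos.le
  have hb : 0 ≤ cross b u x / cross b u v := div_nonneg hx.1 h.pos.le
  have := hP.convex.sum_mem (t := Finset.univ) (z := ![0, u, v])
    (w := ![1 - (cross b x v / cross b u v + cross b u x / cross b u v), cross b x v / cross b u v,
      cross b u x / cross b u v])
    (by intro i _; fin_cases i <;> simp <;> linarith)
    (by simp [Fin.sum_univ_three]; ring)
    (by
      intro i _
      fin_cases i
      · exact hP.zero_mem
      · exact hP.vertex_mem h.left_mem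
      · exact hP.vertex_mem h.right_mem)
  simpa [Fin.sum_univ_three] using this

lemma sum_edges_fst (hP : IsPolygon b P V) (f : E → ℝ) :
    ∑ σ ∈ edges b V, f σ.1 = ∑ u ∈ V, f u := by
  refine Finset.sum_nbij Prod.fst ?_ ?_ ?_ fun _ _ => rfl
  · exact fun σ hσ => (mem_edges.1 hσ).left_mem
  · intro σ hσ τ hτ h
    have h1 := mem_edges.1 hσ
    have h2 := mem_edges.1 hτ
    rw [h] at h1
    exact Prod.ext h (hP.right_unique h1 h2)
  · intro u hu
    obtain ⟨v, hv⟩ := hP.exists_isEdge_left hu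
    exact ⟨(u, v), mem_edges.2 hv, rfl⟩

lemma sum_edges_snd (hP : IsPolygon b P V) (f : E → ℝ) :
    ∑ σ ∈ edges b V, f σ.2 = ∑ u ∈ V, f u := by
  refine Finset.sum_nbij Prod.snd ?_ ?_ ?_ fun _ _ => rfl
  · exact fun σ hσ => (mem_edges.1 hσ).right_mem
  · intro σ hσ τ hτ h
    have h1 := mem_edges.1 hσ
    have h2 := mem_edges.1 hτ
    rw [h] at h1
    exact Prod.ext (hP.left_unique h1 h2) h
  · intro v hv
    obtain ⟨u, hu⟩ := hP.exists_isEdge_right hv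
    exact ⟨(u, v), mem_edges.2 hu, rfl⟩

end IsPolygon

end Polygon

/-! ### Lattice points in a cone and Noether's formula -/

lemma exists_generic_slope {E : Type*} {V : Finset E} (p q : E → ℤ)
    (hV : ∀ u ∈ V, IsCoprime (p u) (q u)) :
    ∃ K : ℤ, ∀ u ∈ V, q u - K * p u ≠ 0 := by
  classical
  obtain ⟨K, hK⟩ := Infinite.exists_notMem_finset (V.image fun u => q u / p u)
  refine ⟨K, fun u hu h0 => ?_⟩
  by_cases hp : p u = 0
  · have h1 := hV u hu
    rw [hp, mul_zero, sub_zero] at h0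
    rw [hp, h0] at h1
    exact not_isCoprime_zero_zero h1
  · exact hK (Finset.mem_image.2 ⟨u, hu, by
      rw [sub_eq_zero.1 h0]
      exact Int.mul_ediv_cancel _ hp⟩)

section Lattice

variable {E : Type*} [AddCommGroup E] [Module ℝ E] {b : Basis (Fin 2) ℝ E} {P : Set E}
  {V : Finset E}

/-- The integral vectors with respect to a basis. -/
def IsIntegral (b : Basis (Fin 2) ℝ E) (n : E) : Prop :=
  ∃ i j : ℤ, n = (i : ℝ) • b 0 + (j : ℝ) • b 1

lemma coord_zero_combo (b : Basis (Fin 2) ℝ E) (x y : ℝ) : b.coord 0 (x • b 0 + y • b 1) = x := by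
  simp

lemma coord_one_combo (b : Basis (Fin 2) ℝ E) (x y : ℝ) : b.coord 1 (x • b 0 + y • b 1) = y := by
  simp

lemma eq_combo (b : Basis (Fin 2) ℝ E) (x : E) : x = b.coord 0 x • b 0 + b.coord 1 x • b 1 := by
  conv_lhs => rw [← b.sum_repr x]
  exact Fin.sum_univ_two _

lemma cross_combo (b : Basis (Fin 2) ℝ E) (x y z w : ℝ) :
    cross b (x • b 0 + y • b 1) (z • b 0 + w • b 1) = x * w - y * z := by
  rw [cross_apply, coord_zero_combo, coord_zero_combo, coord_one_combo, coord_one_combo]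

/-- The lattice points of the triangle `0, u, v` off the rays through `u` and `v`, enumerated by
their determinant with `u`. -/
lemma exists_sum_triangle {p q p' q' : ℤ} {u v : E} (hu : u = (p : ℝ) • b 0 + (q : ℝ) • b 1)
    (hv : v = (p' : ℝ) • b 0 + (q' : ℝ) • b 1) (hpq : IsCoprime p q) (hpq' : IsCoprime p' q')
    (hpos : 0 < cross b u v) (A : Finset E)
    (hA : ∀ n, n ∈ A ↔ IsIntegral b n ∧ 0 < cross b u n ∧ 0 < cross b n v ∧
      edgeForm b u v n ≤ 1) :
    ∃ h : ℤ, (p * q' - q * p') ∣ p' - h * p ∧ (p * q' - q * p') ∣ q' - h * q ∧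
      IsCoprime h (p * q' - q * p') ∧
      2 * ∑ n ∈ A, (1 - edgeForm b u v n) ^ 2 = ∑ j ∈ Finset.Ioo 0 (p * q' - q * p'),
        (Int.fract ((h * j : ℝ) / (p * q' - q * p' : ℤ)) - j / (p * q' - q * p' : ℤ)) ^ 2 := by
  obtain ⟨d, hd⟩ : ∃ d, d = p * q' - q * p' := ⟨_, rfl⟩
  rw [← hd]
  obtain ⟨α, β, hαβ⟩ := hpq
  -- Bézout completes `u` to a lattice basis `u, us` of determinant 1, in which `v = h u + d us`.
  obtain ⟨us, hus⟩ : ∃ us : E, us = ((-β : ℤ) : ℝ) • b 0 + (α : ℝ) • b 1 := ⟨_, rfl⟩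
  obtain ⟨h, hh⟩ : ∃ h, h = p' * α + q' * β := ⟨_, rfl⟩
  have hp' : p' - h * p = d * (-β) := by
    rw [hh, hd]; linear_combination (-p') * hαβ
  have hq' : q' - h * q = d * α := by
    rw [hh, hd]; linear_combination (-q') * hαβ
  have hcop : IsCoprime h d := by
    obtain ⟨x, y, hxy⟩ := hpq'
    exact ⟨x * p + y * q, -x * β + y * α, by linear_combination hxy - x * hp' - y * hq'⟩
  have hduv : cross b u v = d := by
    rw [hu, hv, cross_combo, hd]; push_cast; ring
  have hd0 : 0 < d := by rw [hduv] at hpos; exact_mod_cast hpos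
  have hd0' : (0 : ℝ) < d := by exact_mod_cast hd0
  have huus : cross b u us = 1 := by
    rw [hu, hus, cross_combo]
    have : (α : ℝ) * p + β * q = 1 := by exact_mod_cast hαβ
    push_cast
    linarith
  have hveq : v = (h : ℝ) • u + (d : ℝ) • us := by
    have e := cross_smul_eq b u us v
    rw [huus, one_smul, hduv] at e
    rw [e, hv, hus, cross_combo, hh]
    push_cast
    congr 2
    ring
  have hint : ∀ i j : ℤ, IsIntegral b ((i : ℝ) • u + (j : ℝ) • us) := by
    intro i j
    refine ⟨i * p - j * β, i * q + j * α, ?_⟩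
    rw [hu, hus]
    push_cast
    module
  have hcoord : ∀ n, IsIntegral b n → ∃ i j : ℤ, n = (i : ℝ) • u + (j : ℝ) • us := by
    rintro n ⟨i, j, rfl⟩
    have e := cross_smul_eq b u us ((i : ℝ) • b 0 + (j : ℝ) • b 1)
    rw [huus, one_smul] at e
    refine ⟨i * α + j * β, p * j - q * i, e.trans ?_⟩
    conv_lhs => rw [hus, cross_combo, ← hus, hu, cross_combo, ← hu]
    push_cast
    congr 2
    ring
  have hc1 : ∀ i j : ℝ, cross b u (i • u + j • us) = j := by
    intro i j
    simp [cross_self, huus]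
  have hc2 : ∀ i j : ℝ, cross b (i • u + j • us) v = i * d - j * h := by
    intro i j
    rw [hveq]
    simp only [map_add, map_smul, LinearMap.add_apply, LinearMap.smul_apply, smul_eq_mul,
      cross_self, huus, cross_swap b us u]
    ring
  have hform : ∀ i j : ℝ, edgeForm b u v (i • u + j • us) = i - h * j / d + j / d := by
    intro i j
    rw [edgeForm_apply, hc1, hc2, hduv]
    field_simp
    ring
  have hfr : ∀ j ∈ Finset.Ioo 0 d, (0 : ℝ) < j ∧ Int.fract ((h * j : ℝ) / d) < 1 := by
    intro j hj
    rw [Finset.mem_Ioo] at hj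
    exact ⟨by exact_mod_cast hj.1, Int.fract_lt_one _⟩
  refine ⟨h, ⟨_, hp'⟩, ⟨_, hq'⟩, hcop, ?_⟩
  rw [← sum_fract_sub_sq_filter hd0 hcop]
  congr 1
  have hmem : ∀ i j : ℤ, (i : ℝ) • u + (j : ℝ) • us ∈ A ↔
      0 < j ∧ (0 : ℝ) < i - h * j / d ∧ (i : ℝ) - h * j / d + j / d ≤ 1 := by
    intro i j
    have : (0 : ℝ) < i * d - j * h ↔ (0 : ℝ) < i - h * j / d := by
      rw [show (i * d - j * h : ℝ) = (i - h * j / d) * d by field_simp]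
      exact mul_pos_iff_of_pos_right hd0'
    rw [hA, hc1, hc2, hform, this]
    simp only [hint i j, true_and, Int.cast_pos]
  have hi : ∀ i j : ℤ, (i : ℝ) • u + (j : ℝ) • us ∈ A →
      i = ⌊(h * j : ℝ) / d⌋ + 1 ∧ Int.fract ((h * j : ℝ) / d) = 1 - (i - h * j / d) ∧
      j ∈ Finset.Ioo 0 d := by
    intro i j hij
    obtain ⟨h1, h2, h3⟩ := (hmem i j).1 hij
    -- From `0 < i - hj/d ≤ 1 - j/d < 1` the coordinate `j` determines `i`.
    have hj : (0 : ℝ) < j / d := div_pos (by exact_mod_cast h1) hd0'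
    have hfl : ⌊(h * j : ℝ) / d⌋ = i - 1 := by
      rw [Int.floor_eq_iff]
      push_cast
      constructor <;> linarith
    refine ⟨by omega, ?_, ?_⟩
    · rw [Int.fract, hfl]
      push_cast
      ring
    · rw [Finset.mem_Ioo]
      refine ⟨h1, ?_⟩
      have : (j : ℝ) / d < 1 := by linarith
      rw [div_lt_one hd0'] at this
      exact_mod_cast this
  refine Finset.sum_nbij' (fun n => ⌊cross b u n⌋)
    (fun j : ℤ => ((⌊(h * j : ℝ) / d⌋ + 1 : ℤ) : ℝ) • u + (j : ℝ) • us) ?_ ?_ ?_ ?_ ?_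
  · intro n hn
    obtain ⟨i, j, rfl⟩ := hcoord n ((hA n).1 hn).1
    obtain ⟨h1, h2, h3⟩ := hi i j hn
    rw [hc1, Int.floor_intCast, Finset.mem_filter, h2]
    exact ⟨h3, by linarith [((hmem i j).1 hn).2.2]⟩
  · intro j hj
    rw [Finset.mem_filter, Int.fract] at hj
    rw [hmem]
    have := Int.lt_floor_add_one ((h * j : ℝ) / d)
    push_cast
    exact ⟨(Finset.mem_Ioo.1 hj.1).1, by linarith, by linarith [hj.2]⟩
  · intro n hn
    obtain ⟨i, j, rfl⟩ := hcoord n ((hA n).1 hn).1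
    rw [hc1, Int.floor_intCast, ← (hi i j hn).1]
  · intro j _
    rw [hc1, Int.floor_intCast]
  · intro n hn
    obtain ⟨i, j, rfl⟩ := hcoord n ((hA n).1 hn).1
    rw [hc1, Int.floor_intCast, hform, (hi i j hn).2.1]
    ring

/-- Exactly two edges are crossed by the line through a vector parallel to no vertex. -/
lemma IsPolygon.sum_sign [Nontrivial E] (hP : IsPolygon b P V) {e : E}
    (he : ∀ u ∈ V, cross b e u ≠ 0) :
    ∑ σ ∈ edges b V, (1 - SignType.sign (cross b e σ.1 * cross b e σ.2) : ℝ) = 4 := by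
  classical
  -- The edges met by the rays of `e` and of `-e` contribute 2 each; any other edge has both ends on
  -- the same side of the line.
  obtain ⟨u, v, h, hc⟩ := hP.exists_inCone e
  obtain ⟨u', v', h', hc'⟩ := hP.exists_inCone (-e)
  have e1 : cross b e u < 0 := by
    refine lt_of_le_of_ne ?_ (he u h.left_mem)
    rw [cross_swap]; linarith [hc.1]
  have e2 : 0 < cross b e v := lt_of_le_of_ne hc.2 (he v h.right_mem).symm
  have e3 : 0 < cross b e u' := by
    refine lt_of_le_of_ne ?_ (he u' h'.left_mem).symm
    have := hc'.1
    rwa [cross_swap, map_neg, LinearMap.neg_apply, neg_neg] at this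
  have e4 : cross b e v' < 0 := by
    refine lt_of_le_of_ne ?_ (he v' h'.right_mem)
    have := hc'.2
    rw [map_neg, LinearMap.neg_apply] at this
    linarith
  have hne : (u, v) ≠ (u', v') := by
    intro heq
    rw [Prod.mk.injEq] at heq
    rw [heq.1] at e1
    linarith
  have hsub : ({(u, v), (u', v')} : Finset (E × E)) ⊆ edges b V := by
    intro σ hσ
    rw [Finset.mem_insert, Finset.mem_singleton] at hσ
    rcases hσ with rfl | rfl
    · exact mem_edges.2 h
    · exact mem_edges.2 h'
  rw [← Finset.sum_subset hsub, Finset.sum_pair hne]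
  · rw [sign_neg (mul_neg_of_neg_of_pos e1 e2), sign_neg (mul_neg_of_pos_of_neg e3 e4)]
    norm_num
  · intro σ hσ hσ2
    have hσ' := mem_edges.1 hσ
    rcases lt_or_gt_of_ne (he _ hσ'.left_mem) with h1 | h1 <;>
      rcases lt_or_gt_of_ne (he _ hσ'.right_mem) with h2 | h2
    · rw [sign_pos (mul_pos_of_neg_of_neg h1 h2)]
      simp
    · exfalso
      have := hP.eq_of_inCone_of_pos hσ' h (x := e) (by rw [cross_swap]; linarith) h2 hc
      exact hσ2 (by simp [← this.1, ← this.2])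
    · exfalso
      have := hP.eq_of_inCone_of_pos hσ' h' (x := -e) (by rw [cross_swap]; simpa using h1)
        (by simpa using h2) hc'
      exact hσ2 (by simp [← this.1, ← this.2])
    · rw [sign_pos (mul_pos h1 h2)]
      simp

/-- Twice the area of the triangle in the dual polygon that corresponds to the vertex `u` with
neighbours `t` and `v`. -/
noncomputable def dualArea (b : Basis (Fin 2) ℝ E) (t u v : E) : ℝ :=
  cross b (t - u) (u - v) / (cross b t u * cross b u v)

/-- Noether's formula for a polygon with primitive vertices. -/
theorem IsPolygon.noether [Nontrivial E] (hP : IsPolygon b P V) (p q : E → ℤ)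
    (hpq : ∀ u ∈ V, u = (p u : ℝ) • b 0 + (q u : ℝ) • b 1)
    (hcop : ∀ u ∈ V, IsCoprime (p u) (q u)) (h : E × E → ℤ)
    (h1 : ∀ σ ∈ edges b V,
      p σ.1 * q σ.2 - q σ.1 * p σ.2 ∣ p σ.2 - h σ * p σ.1)
    (h2 : ∀ σ ∈ edges b V,
      p σ.1 * q σ.2 - q σ.1 * p σ.2 ∣ q σ.2 - h σ * q σ.1)
    (next : E → E) (hnext : ∀ u ∈ V, IsEdge b V u (next u)) :
    12 + ∑ σ ∈ edges b V, (2 / cross b σ.1 σ.2 - 3 -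
        12 * dedekindSum (h σ) (p σ.1 * q σ.2 - q σ.1 * p σ.2)) =
      ∑ σ ∈ edges b V, dualArea b σ.1 σ.2 (next σ.2) := by
  -- An integral shear makes every second coordinate `Q` nonzero; equivalently, `e = (1, K)` is
  -- parallel to no vertex.
  obtain ⟨K, hK⟩ := exists_generic_slope p q hcop
  obtain ⟨Q, hQ⟩ : ∃ Q : E → ℤ, Q = fun u => q u - K * p u := ⟨_, rfl⟩
  obtain ⟨e, he⟩ : ∃ e : E, e = (1 : ℝ) • b 0 + (K : ℝ) • b 1 := ⟨_, rfl⟩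
  have hQe : ∀ u ∈ V, cross b e u = Q u := by
    intro u hu
    rw [he]
    conv_lhs => rw [hpq u hu]
    rw [cross_combo, hQ]
    push_cast
    ring
  have hQ0 : ∀ u ∈ V, Q u ≠ 0 := by
    intro u hu
    rw [hQ]
    exact hK u hu
  have hQ0' : ∀ u ∈ V, (Q u : ℝ) ≠ 0 := fun u hu => by exact_mod_cast hQ0 u hu
  have hd : ∀ σ ∈ edges b V, cross b σ.1 σ.2 = (p σ.1 * q σ.2 - q σ.1 * p σ.2 : ℤ) := by
    intro σ hσ
    have hσ' := mem_edges.1 hσ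
    conv_lhs => rw [hpq _ hσ'.left_mem, hpq _ hσ'.right_mem]
    rw [cross_combo]
    push_cast
    ring
  have hsign := hP.sum_sign (e := e) fun u hu => by
    rw [hQe u hu]
    exact hQ0' u hu
  -- The three-term law, with its summand `d / (Q Q')` rewritten as `p/Q - p'/Q'`; the last two
  -- lines of the formula then telescope.
  have hterm : ∀ σ ∈ edges b V, 2 / cross b σ.1 σ.2 - 3 -
        12 * dedekindSum (h σ) (p σ.1 * q σ.2 - q σ.1 * p σ.2) =
      (1 / cross b σ.1 σ.2 - Q σ.1 / (Q σ.2 * cross b σ.1 σ.2)) +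
      (1 / cross b σ.1 σ.2 - Q σ.2 / (Q σ.1 * cross b σ.1 σ.2)) -
      3 * (1 - SignType.sign (cross b e σ.1 * cross b e σ.2) : ℝ) +
      (12 * dedekindSum (p σ.1) (Q σ.1) - p σ.1 / Q σ.1) -
      (12 * dedekindSum (p σ.2) (Q σ.2) - p σ.2 / Q σ.2) := by
    intro σ hσ
    have hσ' := mem_edges.1 hσ
    have hdσ := hd σ hσ
    have hpos := hσ'.pos
    have n1 := hQ0' _ hσ'.left_mem
    have n2 := hQ0' _ hσ'.right_mem
    obtain ⟨d, hdd⟩ : ∃ d, d = p σ.1 * q σ.2 - q σ.1 * p σ.2 := ⟨_, rfl⟩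
    rw [← hdd] at hdσ
    have hd0 : 0 < d := by
      rw [hdσ] at hpos
      exact_mod_cast hpos
    have hdR : (d : ℝ) ≠ 0 := by exact_mod_cast hd0.ne'
    have hdet : p σ.1 * Q σ.2 - Q σ.1 * p σ.2 = d := by
      rw [hQ, hdd]
      ring
    have hcopQ : IsCoprime (p σ.2) (Q σ.2) := by
      rw [hQ]
      have := (hcop _ hσ'.right_mem).add_mul_left_right (-K)
      rwa [show q σ.2 + p σ.2 * -K = q σ.2 - K * p σ.2 by ring] at this
    have g1 := h1 σ hσ
    have g2 := h2 σ hσ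
    rw [← hdd] at g1 g2
    have g3 : d ∣ Q σ.2 - h σ * Q σ.1 := by
      have := dvd_sub g2 (g1.mul_left K)
      rw [hQ]
      simp only
      rwa [show q σ.2 - h σ * q σ.1 - K * (p σ.2 - h σ * p σ.1) =
        q σ.2 - K * p σ.2 - h σ * (q σ.1 - K * p σ.1) by ring] at this
    have law := dedekindSum_three_term hcopQ (hQ0 _ hσ'.left_mem) (hQ0 _ hσ'.right_mem)
      hdet hd0 g1 g3
    have hs : ((Q σ.1 * Q σ.2).sign : ℝ) = SignType.sign (cross b e σ.1 * cross b e σ.2) := by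
      rw [hQe _ hσ'.left_mem, hQe _ hσ'.right_mem]
      rcases lt_or_gt_of_ne (mul_ne_zero (hQ0 _ hσ'.left_mem) (hQ0 _ hσ'.right_mem)) with hl | hl
      · rw [Int.sign_eq_neg_one_of_neg hl, sign_neg (by exact_mod_cast hl)]
        simp
      · rw [Int.sign_eq_one_of_pos hl, sign_pos (by exact_mod_cast hl)]
        simp
    rw [← hdd, law, ← hs, hdσ]
    have hdetR : (p σ.1 : ℝ) * Q σ.2 - Q σ.1 * p σ.2 = d := by exact_mod_cast hdet
    field_simp
    linear_combination (4 * (d : ℝ)) * hdetR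
  have hdual : ∀ σ ∈ edges b V, dualArea b σ.1 σ.2 (next σ.2) =
      (1 / cross b σ.1 σ.2 - Q σ.1 / (Q σ.2 * cross b σ.1 σ.2)) +
      (1 / cross b σ.2 (next σ.2) - Q (next σ.2) / (Q σ.2 * cross b σ.2 (next σ.2))) := by
    intro σ hσ
    have hσ' := mem_edges.1 hσ
    have hσ'' := hnext _ hσ'.right_mem
    have n2 := hQ0' _ hσ'.right_mem
    have n3 := hσ'.pos.ne'
    have n4 := hσ''.pos.ne'
    -- The Plücker relation between `e` and three consecutive vertices.
    have pl := congrArg (fun z => cross b z (next σ.2)) (cross_smul_eq b e σ.2 σ.1)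
    simp only [map_add, map_smul, LinearMap.add_apply, LinearMap.smul_apply, smul_eq_mul,
      hQe _ hσ'.right_mem, hQe _ hσ'.left_mem, hQe _ hσ''.right_mem] at pl
    simp only [dualArea, map_sub, LinearMap.sub_apply, cross_self]
    field_simp
    linear_combination (-1 : ℝ) * pl
  -- The second half of each dual triangle belongs to the following edge, so a cyclic shift matches
  -- the two sums.
  have hshift : ∑ σ ∈ edges b V,
      (1 / cross b σ.2 (next σ.2) - Q (next σ.2) / (Q σ.2 * cross b σ.2 (next σ.2))) =
      ∑ σ ∈ edges b V, (1 / cross b σ.1 σ.2 - Q σ.2 / (Q σ.1 * cross b σ.1 σ.2)) := by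
    rw [hP.sum_edges_snd (fun u => 1 / cross b u (next u) - Q (next u) / (Q u * cross b u (next u))),
      ← hP.sum_edges_fst]
    refine Finset.sum_congr rfl fun σ hσ => ?_
    have hσ' := mem_edges.1 hσ
    rw [hP.right_unique (hnext _ hσ'.left_mem) hσ']
  rw [Finset.sum_congr rfl hterm, Finset.sum_congr rfl hdual]
  rw [Finset.sum_sub_distrib, Finset.sum_add_distrib, Finset.sum_sub_distrib,
    Finset.sum_add_distrib, Finset.sum_add_distrib, ← Finset.mul_sum, hsign, hshift,
    hP.sum_edges_fst (fun u => 12 * dedekindSum (p u) (Q u) - p u / Q u),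
    hP.sum_edges_snd (fun u => 12 * dedekindSum (p u) (Q u) - p u / Q u)]
  ring

end Lattice

/-! ### Areas of triangles and of triangulated regions -/

section Triangle

variable {E : Type*} [AddCommGroup E] [Module ℝ E]

lemma mem_convexHull_triangle {x y z : E} :
    z ∈ convexHull ℝ {0, x, y} ↔ ∃ s t : ℝ, 0 ≤ s ∧ 0 ≤ t ∧ s + t ≤ 1 ∧ z = s • x + t • y := by
  constructor
  · intro hz
    have : convexHull ℝ {0, x, y} ⊆
        {z | ∃ s t : ℝ, 0 ≤ s ∧ 0 ≤ t ∧ s + t ≤ 1 ∧ z = s • x + t • y} := by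
      refine convexHull_min ?_ ?_
      · rintro w (rfl | rfl | rfl)
        · exact ⟨0, 0, le_rfl, le_rfl, by norm_num, by simp⟩
        · exact ⟨1, 0, by norm_num, le_rfl, by norm_num, by simp⟩
        · exact ⟨0, 1, le_rfl, by norm_num, by norm_num, by simp⟩
      · rintro _ ⟨s, t, hs, ht, hst, rfl⟩ _ ⟨s', t', hs', ht', hst', rfl⟩ α β hα hβ hαβ
        refine ⟨α * s + β * s', α * t + β * t', by positivity, by positivity, ?_, ?_⟩
        · nlinarith
        · module
    exact this hz
  · rintro ⟨s, t, hs, ht, hst, rfl⟩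
    have := (convex_convexHull ℝ {0, x, y}).sum_mem (t := Finset.univ) (z := ![0, x, y])
      (w := ![1 - (s + t), s, t])
      (by intro i _; fin_cases i <;> simp <;> linarith)
      (by simp [Fin.sum_univ_three]; ring)
      (by
        intro i _
        apply subset_convexHull
        fin_cases i <;> simp)
    simpa [Fin.sum_univ_three] using this

end Triangle

lemma isCompact_triangle {E : Type*} [NormedAddCommGroup E] [NormedSpace ℝ E] (x y : E) :
    IsCompact (convexHull ℝ {0, x, y}) :=
  (Set.toFinite _).isCompact_convexHull ℝ

section Measure

variable {E : Type*} [NormedAddCommGroup E] [NormedSpace ℝ E] [FiniteDimensional ℝ E]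
  [MeasurableSpace E] [BorelSpace E] (b : Basis (Fin 2) ℝ E) (μ : Measure E)
  [μ.IsAddHaarMeasure]

lemma measure_ker_eq_zero {f : E →ₗ[ℝ] ℝ} (hf : f ≠ 0) : μ {x | f x = 0} = 0 :=
  Measure.addHaar_submodule μ (LinearMap.ker f) fun h => hf (LinearMap.ker_eq_top.1 h)

lemma measure_level_eq_zero {f : E →ₗ[ℝ] ℝ} {x₀ : E} (h₀ : f x₀ = 1) : μ {x | f x = 1} = 0 := by
  have hf : f ≠ 0 := by
    rintro rfl
    simp at h₀
  have : {x | f x = 1} = (fun x => x + -x₀) ⁻¹' {x | f x = 0} := by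
    ext x
    simp only [Set.mem_ofPred_eq, Set.mem_preimage, map_add, map_neg, h₀]
    constructor <;> intro h <;> linarith
  rw [this, measure_preimage_add_right, measure_ker_eq_zero μ hf]

/-- The reflection `z ↦ b 0 + b 1 - z` carries the triangle to the other half of the parallelogram,
and the halves meet in a null line. -/
lemma measureReal_triangle_basis :
    μ.real (convexHull ℝ {0, b 0, b 1}) = μ.real (ZSpan.fundamentalDomain b) / 2 := by
  set T : Set E := convexHull ℝ {0, b 0, b 1} with hT
  set T' : Set E := (fun z => (b 0 + b 1) - z) ⁻¹' T with hT'
  have hTm : MeasurableSet T := (isCompact_triangle _ _).isClosed.measurableSet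
  have hmem : ∀ z, z ∈ T ↔ 0 ≤ b.coord 0 z ∧ 0 ≤ b.coord 1 z ∧ b.coord 0 z + b.coord 1 z ≤ 1 := by
    intro z
    rw [hT, mem_convexHull_triangle]
    constructor
    · rintro ⟨s, t, hs, ht, hst, rfl⟩
      rw [coord_zero_combo, coord_one_combo]
      exact ⟨hs, ht, hst⟩
    · rintro ⟨h1, h2, h3⟩
      exact ⟨_, _, h1, h2, h3, eq_combo b z⟩
  have hmem' : ∀ z, z ∈ T' ↔ b.coord 0 z ≤ 1 ∧ b.coord 1 z ≤ 1 ∧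
      1 ≤ b.coord 0 z + b.coord 1 z := by
    intro z
    rw [hT', Set.mem_preimage, hmem]
    simp only [map_sub, map_add, Basis.coord_apply, Basis.repr_self]
    simp
    intro h1 h2
    constructor <;> intro h <;> linarith
  have hTm' : MeasurableSet T' := hTm.preimage (measurable_const.sub measurable_id)
  have hμT' : μ T' = μ T :=
    (Measure.measurePreserving_sub_left μ (b 0 + b 1)).measure_preimage hTm.nullMeasurableSet
  have hpar : parallelepiped b = T ∪ T' := by
    ext z
    rw [parallelepiped_basis_eq, Set.mem_union, hmem, hmem']
    simp only [Set.mem_ofPred_eq, Fin.forall_fin_two, Set.mem_Icc, Basis.coord_apply]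
    constructor
    · rintro ⟨⟨h1, h2⟩, h3, h4⟩
      rcases le_total (b.repr z 0 + b.repr z 1) 1 with h | h
      · exact Or.inl ⟨h1, h3, h⟩
      · exact Or.inr ⟨h2, h4, h⟩
    · rintro (⟨h1, h2, h3⟩ | ⟨h1, h2, h3⟩) <;> refine ⟨⟨?_, ?_⟩, ?_, ?_⟩ <;> linarith
  have hdisj : AEDisjoint μ T T' := by
    refine measure_mono_null ?_ (measure_level_eq_zero μ (f := b.coord 0 + b.coord 1) (x₀ := b 0)
      (by simp))
    rintro z ⟨h1, h2⟩
    rw [hmem] at h1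
    rw [hmem'] at h2
    exact le_antisymm h1.2.2 h2.2.2
  have hfin : μ T ≠ ⊤ := (isCompact_triangle _ _).measure_ne_top
  have key : μ.real (ZSpan.fundamentalDomain b) = μ.real T + μ.real T := by
    rw [measureReal_def, measure_congr (ZSpan.fundamentalDomain_ae_parallelepiped b μ), hpar,
      measure_union₀ hTm'.nullMeasurableSet hdisj, hμT', ENNReal.toReal_add hfin hfin]
    rfl
  rw [key]
  ring

lemma measureReal_triangle (x y : E) :
    μ.real (convexHull ℝ {0, x, y}) =
      |cross b x y| / 2 * μ.real (ZSpan.fundamentalDomain b) := by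
  set f : E →ₗ[ℝ] E := b.constr ℝ ![x, y] with hf
  have h0 : f (b 0) = x := by simp [hf]
  have h1 : f (b 1) = y := by simp [hf]
  have himg : convexHull ℝ {0, x, y} = f '' convexHull ℝ {0, b 0, b 1} := by
    rw [f.image_convexHull]
    simp [Set.image_insert_eq, h0, h1]
  have hdet : LinearMap.det f = cross b x y := by
    rw [← LinearMap.det_toMatrix b, Matrix.det_fin_two]
    simp only [LinearMap.toMatrix_apply, h0, h1, cross_apply, Basis.coord_apply]
    ring
  rw [himg, measureReal_def, Measure.addHaar_image_linearMap, hdet, ENNReal.toReal_mul,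
    ENNReal.toReal_ofReal (abs_nonneg _), ← measureReal_def, measureReal_triangle_basis]
  ring

/-- The normalized area of a region triangulated from the origin. -/
lemma normalizedVolume_eq_sum {L : Submodule ℤ E} (hL : L = Submodule.span ℤ (Set.range b))
    {ι : Type*} (I : Finset ι) (x y : ι → E) (P : Set E)
    (hP : P = ⋃ i ∈ I, convexHull ℝ {0, x i, y i})
    (hdisj : ∀ i ∈ I, ∀ j ∈ I, i ≠ j → ∃ f : E →ₗ[ℝ] ℝ, f ≠ 0 ∧
      ∀ z ∈ convexHull ℝ {0, x i, y i}, z ∈ convexHull ℝ {0, x j, y j} → f z = 0) :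
    normalizedVolume L P = ∑ i ∈ I, |cross b (x i) (y i)| := by
  have hrank : finrank ℝ E = 2 := by rw [finrank_eq_card_basis b, Fintype.card_fin]
  have hcov : ZLattice.covolume L (Measure.addHaar : Measure E) =
      (Measure.addHaar : Measure E).real (ZSpan.fundamentalDomain b) := by
    subst hL
    exact ZLattice.covolume_eq_measure_fundamentalDomain _ _ (ZSpan.isAddFundamentalDomain b _)
  have hne : (Measure.addHaar : Measure E).real (ZSpan.fundamentalDomain b) ≠ 0 := by
    rw [measureReal_def, ENNReal.toReal_ne_zero]
    refine ⟨ZSpan.measure_fundamentalDomain_ne_zero b, ?_⟩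
    exact (ZSpan.fundamentalDomain_isBounded b).measure_lt_top.ne
  have hmeas : (Measure.addHaar : Measure E).real P =
      ∑ i ∈ I, (Measure.addHaar : Measure E).real (convexHull ℝ {0, x i, y i}) := by
    rw [hP]
    refine measureReal_biUnion_finset₀ ?_ ?_ ?_
    · intro i hi j hj hij
      obtain ⟨f, hf, hz⟩ := hdisj i hi j hj hij
      exact measure_mono_null (fun z h => hz z h.1 h.2) (measure_ker_eq_zero _ hf)
    · exact fun i _ => (isCompact_triangle _ _).isClosed.measurableSet.nullMeasurableSet
    · exact fun i _ => (isCompact_triangle _ _).measure_ne_top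
  rw [normalizedVolume, hrank, hcov, hmeas]
  simp only [measureReal_triangle b]
  rw [← Finset.sum_mul, mul_div_assoc, div_self hne, ← Finset.sum_div]
  simp [Nat.factorial]
  ring

end Measure

/-! ### Triangulating the polygon from the origin -/

section Plane

variable {E : Type*} [AddCommGroup E] [Module ℝ E] {b : Basis (Fin 2) ℝ E} {P : Set E}
  {V : Finset E}

lemma exists_cross_pos_of_ne_zero (b : Basis (Fin 2) ℝ E) {x : E} (hx : x ≠ 0) :
    ∃ y, 0 < cross b x y := by
  refine ⟨(-b.coord 1 x) • b 0 + b.coord 0 x • b 1, ?_⟩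
  rw [cross_apply, coord_zero_combo, coord_one_combo]
  by_contra hle
  have h0 : b.coord 0 x = 0 := by nlinarith [sq_nonneg (b.coord 0 x), sq_nonneg (b.coord 1 x)]
  have h1 : b.coord 1 x = 0 := by nlinarith [sq_nonneg (b.coord 0 x), sq_nonneg (b.coord 1 x)]
  apply hx
  rw [eq_combo b x, h0, h1, zero_smul, zero_smul, add_zero]

lemma linearMap_eq_of_cross_pos {u v : E} (h : 0 < cross b u v) {f g : E →ₗ[ℝ] ℝ}
    (hu : f u = g u) (hv : f v = g v) : f = g := by
  ext x
  have h1 := cross_mul_map (b := b) f u v x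
  have h2 := cross_mul_map (b := b) g u v x
  rw [hu, hv, ← h2] at h1
  exact mul_left_cancel₀ h.ne' h1

lemma mem_triangle_iff {u v z : E} (h : 0 < cross b u v) :
    z ∈ convexHull ℝ {0, u, v} ↔ InCone b u v z ∧ edgeForm b u v z ≤ 1 := by
  rw [mem_convexHull_triangle]
  constructor
  · rintro ⟨s, t, hs, ht, hst, rfl⟩
    have e1 : cross b u (s • u + t • v) = t * cross b u v := by simp [cross_self]
    have e2 : cross b (s • u + t • v) v = s * cross b u v := by simp [cross_self]
    refine ⟨⟨by rw [e1]; positivity, by rw [e2]; positivity⟩, ?_⟩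
    rw [edgeForm_apply, e1, e2, div_le_one h]
    nlinarith
  · rintro ⟨⟨h1, h2⟩, h3⟩
    refine ⟨cross b z v / cross b u v, cross b u z / cross b u v, by positivity, by positivity, ?_,
      eq_of_cross_pos b h z⟩
    rwa [← add_div, add_comm, ← edgeForm_apply]

lemma IsPolygon.eq_biUnion_triangle [Nontrivial E] (hP : IsPolygon b P V) :
    P = ⋃ σ ∈ edges b V, convexHull ℝ {0, σ.1, σ.2} := by
  ext x
  rw [Set.mem_iUnion₂]
  constructor
  · intro hx
    obtain ⟨u, v, h, hc⟩ := hP.exists_inCone x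
    exact ⟨(u, v), mem_edges.2 h, (mem_triangle_iff h.pos).2 ⟨hc, hP.edgeForm_le_of_mem h hx⟩⟩
  · rintro ⟨σ, hσ, hx⟩
    have h := mem_edges.1 hσ
    obtain ⟨h1, h2⟩ := (mem_triangle_iff h.pos).1 hx
    exact hP.mem_of_inCone h h1 h2

/-- Test at `u + v`, which lies in the open cone of the first edge. -/
lemma IsPolygon.edgeForm_injective (hP : IsPolygon b P V) {u v u' v' : E} (h : IsEdge b V u v)
    (h' : IsEdge b V u' v') (heq : edgeForm b u v = edgeForm b u' v') : u = u' ∧ v = v' := by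
  have e1 : cross b u (u + v) = cross b u v := by simp [cross_self]
  have e2 : cross b (u + v) v = cross b u v := by simp [cross_self]
  have hc : InCone b u v (u + v) := ⟨by rw [e1]; exact h.pos.le, by rw [e2]; exact h.pos.le⟩
  refine hP.eq_of_inCone_of_pos h h' (x := u + v) (by rw [e1]; exact h.pos)
    (by rw [e2]; exact h.pos) (hP.inCone_of_forall_le h' fun u'' v'' h'' => ?_)
  rw [← heq]
  exact h.edgeForm_le_of_inCone h'' hc

/-- On the overlap of two cones both edge forms are maximal, so their difference vanishes there. -/
lemma IsPolygon.exists_separating_form (hP : IsPolygon b P V) {σ τ : E × E}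
    (hσ : σ ∈ edges b V) (hτ : τ ∈ edges b V) (hne : σ ≠ τ) :
    ∃ f : E →ₗ[ℝ] ℝ, f ≠ 0 ∧ ∀ z ∈ convexHull ℝ {0, σ.1, σ.2},
      z ∈ convexHull ℝ {0, τ.1, τ.2} → f z = 0 := by
  have h := mem_edges.1 hσ
  have h' := mem_edges.1 hτ
  refine ⟨edgeForm b σ.1 σ.2 - edgeForm b τ.1 τ.2, fun h0 => ?_, fun z hz hz' => ?_⟩
  · have := hP.edgeForm_injective h h' (sub_eq_zero.1 h0)
    exact hne (Prod.ext this.1 this.2)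
  · have c := ((mem_triangle_iff h.pos).1 hz).1
    have c' := ((mem_triangle_iff h'.pos).1 hz').1
    rw [LinearMap.sub_apply, sub_eq_zero]
    exact le_antisymm (h'.edgeForm_le_of_inCone h c') (h.edgeForm_le_of_inCone h' c)

/-- A linear form whose minimum over the vertices is at `u` is a nonnegative combination of the
forms of the two edges at `u`. -/
lemma IsPolygon.exists_combination (hP : IsPolygon b P V) {t u v : E} (h : IsEdge b V t u)
    (h' : IsEdge b V u v) {y : E →ₗ[ℝ] ℝ} (ht : y u ≤ y t) (hv : y u ≤ y v) :
    ∃ r s : ℝ, 0 ≤ r ∧ 0 ≤ s ∧ r + s = -y u ∧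
      y = r • -edgeForm b t u + s • -edgeForm b u v := by
  have h1 := hP.edgeForm_next_lt h h'
  have h2 := hP.edgeForm_prev_lt h h'
  have hne : 1 - edgeForm b t u v ≠ 0 := by linarith
  obtain ⟨r, hr⟩ : ∃ r, r = (y v - y u) / (1 - edgeForm b t u v) := ⟨_, rfl⟩
  have hr0 : 0 ≤ r := by rw [hr]; exact div_nonneg (by linarith) (by linarith)
  have hr1 : r * (1 - edgeForm b t u v) = y v - y u := by rw [hr]; field_simp
  have heq : y = r • -edgeForm b t u + (-y u - r) • -edgeForm b u v := by
    refine linearMap_eq_of_cross_pos h'.pos ?_ ?_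
    · simp only [LinearMap.add_apply, LinearMap.smul_apply, LinearMap.neg_apply, smul_eq_mul,
        h.edgeForm_eq_one_right, h'.edgeForm_eq_one_left]
      ring
    · simp only [LinearMap.add_apply, LinearMap.smul_apply, LinearMap.neg_apply, smul_eq_mul,
        h'.edgeForm_eq_one_right]
      linarith
  refine ⟨r, -y u - r, hr0, ?_, by ring, heq⟩
  have e := LinearMap.congr_fun heq t
  simp only [LinearMap.add_apply, LinearMap.smul_apply, LinearMap.neg_apply, smul_eq_mul,
    h.edgeForm_eq_one_left] at e
  have h3 : 0 ≤ (-y u - r) * (1 - edgeForm b u v t) := by linarith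
  exact nonneg_of_mul_nonneg_left h3 (by linarith)

lemma IsPolygon.dualArea_nonneg {t u v : E} (h : IsEdge b V t u)
    (h' : IsEdge b V u v) : 0 ≤ dualArea b t u v := by
  refine div_nonneg ?_ (mul_pos h.pos h'.pos).le
  have h1 := h.2.2.2 v h'.right_mem
  have h2 := cross_swap b v u
  simp only [map_sub, LinearMap.sub_apply, cross_self]
  linarith

/-- This is the determinant of two consecutive dual vertices in the dual basis; their minus signs
cancel. -/
lemma edgeForm_det {t u v : E} (h : 0 < cross b t u) (h' : 0 < cross b u v) :
    edgeForm b t u (b 0) * edgeForm b u v (b 1) - edgeForm b t u (b 1) * edgeForm b u v (b 0) =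
      dualArea b t u v := by
  have e0 : ∀ x, cross b x (b 0) = -b.coord 1 x := by intro x; simp [cross_apply]
  have e1 : ∀ x, cross b x (b 1) = b.coord 0 x := by intro x; simp [cross_apply]
  have e2 : ∀ x, cross b (b 0) x = b.coord 1 x := by intro x; simp [cross_apply]
  have e3 : ∀ x, cross b (b 1) x = -b.coord 0 x := by intro x; simp [cross_apply]
  simp only [edgeForm_apply, e0, e1, e2, e3, dualArea]
  have e4 : cross b (t - u) (u - v) = (b.coord 0 t - b.coord 0 u) * (b.coord 1 u - b.coord 1 v) -
      (b.coord 1 t - b.coord 1 u) * (b.coord 0 u - b.coord 0 v) := by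
    rw [cross_apply]
    simp only [map_sub]
  rw [e4]
  field_simp
  ring

lemma mem_span_iff_isIntegral {n : E} :
    n ∈ Submodule.span ℤ (Set.range b) ↔ IsIntegral b n := by
  rw [Basis.mem_span_iff_repr_mem]
  constructor
  · intro h
    obtain ⟨i, hi⟩ := h 0
    obtain ⟨j, hj⟩ := h 1
    refine ⟨i, j, ?_⟩
    conv_lhs => rw [eq_combo b n]
    simp only [Basis.coord_apply, ← hi, ← hj]
    rfl
  · rintro ⟨i, j, rfl⟩ k
    fin_cases k
    · exact ⟨i, (coord_zero_combo b _ _).symm⟩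
    · exact ⟨j, (coord_one_combo b _ _).symm⟩

end Plane

/-! ### The dual polygon: triangulation, vertices and area -/

lemma IsPolygon.mem_dualPolytope_iff {E : Type*} [NormedAddCommGroup E] [NormedSpace ℝ E]
    {b : Basis (Fin 2) ℝ E} {P : Set E} {V : Finset E} (hP : IsPolygon b P V) {y : StrongDual ℝ E} :
    y ∈ dualPolytope P ↔ ∀ u ∈ V, -1 ≤ y u := by
  constructor
  · exact fun h u hu => h u (hP.vertex_mem hu)
  · intro h x hx
    rw [hP.eq_hull] at hx
    have : convexHull ℝ (V : Set E) ⊆ {x | -1 ≤ y x} :=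
      convexHull_min h (convex_halfSpace_ge y.toLinearMap.isLinear (-1))
    exact this hx

section Dual

variable {E : Type*} [NormedAddCommGroup E] [NormedSpace ℝ E] [FiniteDimensional ℝ E]
  {b : Basis (Fin 2) ℝ E} {P : Set E} {V : Finset E}

/-- The vertex of the dual polygon that corresponds to the edge from `u` to `v`. -/
noncomputable def dualVertex (b : Basis (Fin 2) ℝ E) (u v : E) : StrongDual ℝ E :=
  LinearMap.toContinuousLinearMap (-edgeForm b u v)

lemma dualVertex_apply (u v x : E) : dualVertex b u v x = -edgeForm b u v x := rfl

/-- The dual basis. -/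
noncomputable def strongDualBasis (b : Basis (Fin 2) ℝ E) : Basis (Fin 2) ℝ (StrongDual ℝ E) :=
  b.dualBasis.map LinearMap.toContinuousLinearMap

lemma strongDualBasis_coord (i : Fin 2) (y : StrongDual ℝ E) :
    (strongDualBasis b).coord i y = y (b i) := by
  simp [strongDualBasis]

lemma dualLattice_eq_span {N : Submodule ℤ E} (hN : N = Submodule.span ℤ (Set.range b)) :
    dualLattice N = Submodule.span ℤ (Set.range (strongDualBasis b)) := by
  subst hN
  ext y
  rw [Basis.mem_span_iff_repr_mem]
  constructor
  · intro h i
    obtain ⟨k, hk⟩ := h (b i) (Submodule.subset_span ⟨i, rfl⟩)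
    refine ⟨k, ?_⟩
    rw [← Basis.coord_apply, strongDualBasis_coord, hk]
    rfl
  · intro h n hn
    obtain ⟨i, j, rfl⟩ := mem_span_iff_isIntegral.1 hn
    obtain ⟨k, hk⟩ := h 0
    obtain ⟨l, hl⟩ := h 1
    rw [← Basis.coord_apply, strongDualBasis_coord] at hk hl
    refine ⟨i * k + j * l, ?_⟩
    rw [map_add, map_smul, map_smul, ← hk, ← hl]
    simp

namespace IsPolygon

lemma dualVertex_mem (hP : IsPolygon b P V) {u v : E} (h : IsEdge b V u v) :
    dualVertex b u v ∈ dualPolytope P := by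
  intro x hx
  have := hP.edgeForm_le_of_mem h hx
  rw [dualVertex_apply]
  linarith

/-- The triangle belonging to `u` consists of the points of the dual polygon that are minimal at `u`
among the vertices. Covering and overlaps are then read off from the minimizing vertex. -/
lemma mem_dualTriangle_iff (hP : IsPolygon b P V) {t u v : E} (h : IsEdge b V t u)
    (h' : IsEdge b V u v) {y : StrongDual ℝ E} :
    y ∈ convexHull ℝ {0, dualVertex b t u, dualVertex b u v} ↔
      (∀ x ∈ V, y u ≤ y x) ∧ -1 ≤ y u := by
  rw [mem_convexHull_triangle]
  constructor
  · rintro ⟨r, s, hr, hs, hrs, rfl⟩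
    simp only [_root_.add_apply, _root_.smul_apply, smul_eq_mul,
      dualVertex_apply, h.edgeForm_eq_one_right, h'.edgeForm_eq_one_left]
    refine ⟨fun x hx => ?_, by linarith⟩
    have h1 := h.edgeForm_le hx
    have h2 := h'.edgeForm_le hx
    nlinarith
  · rintro ⟨h1, h2⟩
    obtain ⟨r, s, hr, hs, hrs, heq⟩ := hP.exists_combination h h' (y := y.toLinearMap)
      (h1 t h.left_mem) (h1 v h'.right_mem)
    refine ⟨r, s, hr, hs, ?_, ?_⟩
    · rw [hrs]
      have : y.toLinearMap u = y u := rfl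
      linarith
    · ext x
      exact LinearMap.congr_fun heq x

lemma exists_mem_dualTriangle [Nontrivial E] (hP : IsPolygon b P V) {y : StrongDual ℝ E}
    (hy : y ∈ dualPolytope P) : ∃ t u, IsEdge b V t u ∧ ∀ v, IsEdge b V u v →
      y ∈ convexHull ℝ {0, dualVertex b t u, dualVertex b u v} := by
  have hne : V.Nonempty := by
    obtain ⟨x, hx⟩ := exists_ne (0 : E)
    obtain ⟨u, hu, -⟩ := hP.exists_cross_pos x hx
    exact ⟨u, hu⟩
  obtain ⟨u, hu, hmin⟩ := Finset.exists_min_image V (fun u => y u) hne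
  obtain ⟨t, ht⟩ := hP.exists_isEdge_right hu
  exact ⟨t, u, ht, fun v hv => (hP.mem_dualTriangle_iff ht hv).2
    ⟨hmin, hP.mem_dualPolytope_iff.1 hy u hu⟩⟩

lemma dualTriangle_subset (hP : IsPolygon b P V) {t u v : E} (h : IsEdge b V t u)
    (h' : IsEdge b V u v) :
    convexHull ℝ {0, dualVertex b t u, dualVertex b u v} ⊆ dualPolytope P := by
  intro y hy
  obtain ⟨h1, h2⟩ := (hP.mem_dualTriangle_iff h h').1 hy
  exact hP.mem_dualPolytope_iff.2 fun x hx => h2.trans (h1 x hx)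

/-- At `u` and `v` the dual vertex attains the lower bound `-1`, so both ends of a segment through
it do too, and a form is determined by these two values. -/
lemma dualVertex_mem_extremePoints (hP : IsPolygon b P V) {u v : E} (h : IsEdge b V u v) :
    dualVertex b u v ∈ (dualPolytope P).extremePoints ℝ := by
  rw [mem_extremePoints_iff_left]
  refine ⟨hP.dualVertex_mem h, ?_⟩
  rintro y hy z hz ⟨α, β, hα, hβ, hαβ, heq⟩
  have key : ∀ x ∈ P, edgeForm b u v x = 1 → y x = -1 := by
    intro x hx hx1
    have h1 := hy x hx
    have h2 := hz x hx
    have h3 := congrArg (fun f : StrongDual ℝ E => f x) heq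
    simp only [_root_.add_apply, _root_.smul_apply, smul_eq_mul,
      dualVertex_apply, hx1] at h3
    nlinarith
  have h4 : y.toLinearMap = (dualVertex b u v).toLinearMap := by
    refine linearMap_eq_of_cross_pos h.pos ?_ ?_
    · change y u = dualVertex b u v u
      rw [dualVertex_apply, h.edgeForm_eq_one_left,
        key u (hP.vertex_mem h.left_mem) h.edgeForm_eq_one_left]
    · change y v = dualVertex b u v v
      rw [dualVertex_apply, h.edgeForm_eq_one_right,
        key v (hP.vertex_mem h.right_mem) h.edgeForm_eq_one_right]
  ext x
  exact LinearMap.congr_fun h4 x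

/-- The origin is a corner of every dual triangle and has to be excluded: it lies strictly between a
dual vertex and a small negative multiple of it. -/
lemma zero_notMem_extremePoints_dualPolytope [Nontrivial E] (hP : IsPolygon b P V) :
    (0 : StrongDual ℝ E) ∉ (dualPolytope P).extremePoints ℝ := by
  intro h0
  obtain ⟨σ, hσ⟩ := hP.edges_nonempty
  have h := mem_edges.1 hσ
  obtain ⟨C, hC⟩ : ∃ C : ℝ, C = 1 + ∑ x ∈ V, |dualVertex b σ.1 σ.2 x| := ⟨_, rfl⟩
  have hC1 : 1 ≤ C := by
    rw [hC]
    have : 0 ≤ ∑ x ∈ V, |dualVertex b σ.1 σ.2 x| := Finset.sum_nonneg fun _ _ => abs_nonneg _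
    linarith
  have hCx : ∀ x ∈ V, dualVertex b σ.1 σ.2 x ≤ C := by
    intro x hx
    have := Finset.single_le_sum (f := fun x => |dualVertex b σ.1 σ.2 x|)
      (fun _ _ => abs_nonneg _) hx
    rw [hC]
    linarith [le_abs_self (dualVertex b σ.1 σ.2 x)]
  have hz : (-C⁻¹) • dualVertex b σ.1 σ.2 ∈ dualPolytope P := by
    rw [hP.mem_dualPolytope_iff]
    intro x hx
    rw [_root_.smul_apply, smul_eq_mul, neg_mul, neg_le_neg_iff,
      inv_mul_le_iff₀ (by linarith), mul_one]
    exact hCx x hx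
  have := (mem_extremePoints_iff_left.1 h0).2 _ (hP.dualVertex_mem h) _ hz
    ⟨1 / (1 + C), C / (1 + C), by positivity, by positivity, by field_simp, by
      rw [smul_smul, ← add_smul]
      have : 1 / (1 + C) + C / (1 + C) * -C⁻¹ = 0 := by field_simp; ring
      rw [this, zero_smul]⟩
  have h2 := congrArg (fun f : StrongDual ℝ E => f σ.1) this
  simp only [dualVertex_apply, h.edgeForm_eq_one_left, _root_.zero_apply] at h2
  norm_num at h2

lemma extremePoints_dualPolytope [Nontrivial E] (hP : IsPolygon b P V) :
    (dualPolytope P).extremePoints ℝ = {y | ∃ u v, IsEdge b V u v ∧ y = dualVertex b u v} := by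
  refine Set.Subset.antisymm (fun y hy => ?_) ?_
  · obtain ⟨t, u, h, hy'⟩ := hP.exists_mem_dualTriangle (extremePoints_subset hy)
    obtain ⟨v, hv⟩ := hP.exists_isEdge_left h.right_mem
    have := extremePoints_convexHull_subset (inter_extremePoints_subset_extremePoints_of_subset
      (hP.dualTriangle_subset h hv) ⟨hy' v hv, hy⟩)
    rcases this with rfl | rfl | rfl
    · exact absurd hy hP.zero_notMem_extremePoints_dualPolytope
    · exact ⟨t, u, h, rfl⟩
    · exact ⟨u, v, hv, rfl⟩
  · rintro _ ⟨u, v, h, rfl⟩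
    exact hP.dualVertex_mem_extremePoints h

lemma normalizedVolume_eq [Nontrivial E] [MeasurableSpace E] [BorelSpace E]
    (hP : IsPolygon b P V) {N : Submodule ℤ E} (hN : N = Submodule.span ℤ (Set.range b)) :
    normalizedVolume N P = ∑ σ ∈ edges b V, cross b σ.1 σ.2 := by
  rw [normalizedVolume_eq_sum b hN (edges b V) Prod.fst Prod.snd P hP.eq_biUnion_triangle
    fun σ hσ τ hτ hne => hP.exists_separating_form hσ hτ hne]
  exact Finset.sum_congr rfl fun σ hσ => abs_of_pos (mem_edges.1 hσ).pos

lemma normalizedVolume_dual_eq [Nontrivial E]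
    (hP : IsPolygon b P V) {N : Submodule ℤ E} (hN : N = Submodule.span ℤ (Set.range b))
    (next : E → E) (hnext : ∀ u ∈ V, IsEdge b V u (next u)) :
    normalizedVolume (dualLattice N) (dualPolytope P) =
      ∑ σ ∈ edges b V, dualArea b σ.1 σ.2 (next σ.2) := by
  rw [normalizedVolume_eq_sum (strongDualBasis b) (dualLattice_eq_span hN) (edges b V)
    (fun σ => dualVertex b σ.1 σ.2) (fun σ => dualVertex b σ.2 (next σ.2)) (dualPolytope P)]
  · refine Finset.sum_congr rfl fun σ hσ => ?_
    have h := mem_edges.1 hσ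
    have h' := hnext _ h.right_mem
    rw [cross_apply, strongDualBasis_coord, strongDualBasis_coord, strongDualBasis_coord,
      strongDualBasis_coord]
    simp only [dualVertex_apply, neg_mul_neg]
    rw [edgeForm_det h.pos h'.pos, abs_of_nonneg (dualArea_nonneg h h')]
  · ext y
    rw [Set.mem_iUnion₂]
    constructor
    · intro hy
      obtain ⟨t, u, h, hy'⟩ := hP.exists_mem_dualTriangle hy
      exact ⟨(t, u), mem_edges.2 h, hy' _ (hnext u h.right_mem)⟩
    · rintro ⟨σ, hσ, hy⟩
      have h := mem_edges.1 hσ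
      exact hP.dualTriangle_subset h (hnext _ h.right_mem) hy
  · intro σ hσ τ hτ hne
    have h := mem_edges.1 hσ
    have h' := mem_edges.1 hτ
    -- A form in both triangles is minimal at both of these distinct vertices, so it vanishes on
    -- their difference.
    have hu : σ.2 ≠ τ.2 := by
      intro heq
      rw [heq] at h
      exact hne (Prod.ext (hP.left_unique h h') heq)
    refine ⟨(ContinuousLinearMap.apply ℝ ℝ (σ.2 - τ.2)).toLinearMap, fun h0 => ?_,
      fun z hz hz' => ?_⟩
    · obtain ⟨y, hy⟩ := exists_cross_pos_of_ne_zero b (sub_ne_zero.2 hu)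
      have := LinearMap.congr_fun h0 (LinearMap.toContinuousLinearMap ((cross b).flip y))
      exact hy.ne' this
    · have h1 := (hP.mem_dualTriangle_iff h (hnext _ h.right_mem)).1 hz
      have h2 := (hP.mem_dualTriangle_iff h' (hnext _ h'.right_mem)).1 hz'
      change z (σ.2 - τ.2) = 0
      rw [map_sub, sub_eq_zero]
      exact le_antisymm (h1.1 _ h'.right_mem) (h2.1 _ h.right_mem)

end IsPolygon

end Dual

/-! ### The face fan and the anticanonical function -/

section Fan

variable {E : Type*} [NormedAddCommGroup E] [NormedSpace ℝ E] {N : Submodule ℤ E}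
  {b : Basis (Fin 2) ℝ E} {P : Set E} {V : Finset E}

lemma IsPrimitive.exists_coprime (hN : N = Submodule.span ℤ (Set.range b)) {u : E}
    (hu : IsPrimitive N u) :
    ∃ p q : ℤ, IsCoprime p q ∧ u = (p : ℝ) • b 0 + (q : ℝ) • b 1 := by
  obtain ⟨huN, -, hprim⟩ := hu
  rw [hN] at huN hprim
  obtain ⟨p, q, rfl⟩ := mem_span_iff_isIntegral.1 huN
  refine ⟨p, q, ?_, rfl⟩
  have h1 : (Int.gcd p q : ℤ) * (p / Int.gcd p q) = p := Int.mul_ediv_cancel' (Int.gcd_dvd_left _ _)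
  have h2 : (Int.gcd p q : ℤ) * (q / Int.gcd p q) = q := Int.mul_ediv_cancel' (Int.gcd_dvd_right _ _)
  have hunit := hprim (((p / Int.gcd p q : ℤ) : ℝ) • b 0 + ((q / Int.gcd p q : ℤ) : ℝ) • b 1)
    (mem_span_iff_isIntegral.2 ⟨_, _, rfl⟩) (Int.gcd p q) (by
      rw [← Int.cast_smul_eq_zsmul ℝ, smul_add, smul_smul, smul_smul, ← Int.cast_mul,
        ← Int.cast_mul, h1, h2])
  rw [Int.isCoprime_iff_gcd_eq_one]
  rcases Int.isUnit_iff.1 hunit with h | h <;> omega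

/-- A multiple of a primitive vector is integral only if the factor is an integer. -/
lemma exists_int_of_smul {p q : ℤ} (hpq : IsCoprime p q) {c : ℝ}
    (h : IsIntegral b (c • ((p : ℝ) • b 0 + (q : ℝ) • b 1))) : ∃ k : ℤ, c = k := by
  obtain ⟨α, β, hαβ⟩ := hpq
  obtain ⟨i, j, hij⟩ := h
  rw [smul_add, smul_smul, smul_smul] at hij
  have h0 := congrArg (b.coord 0) hij
  have h1 := congrArg (b.coord 1) hij
  rw [coord_zero_combo, coord_zero_combo] at h0
  rw [coord_one_combo, coord_one_combo] at h1
  refine ⟨α * i + β * j, ?_⟩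
  have h2 : (α : ℝ) * p + β * q = 1 := by exact_mod_cast hαβ
  push_cast
  linear_combination (-c) * h2 + α * h0 + β * h1

lemma IsLDP.exists_isPolygon (hP : IsLDP N P) (b : Basis (Fin 2) ℝ E) :
    ∃ V : Finset E, (V : Set E) = vertices P ∧ IsPolygon b P V := by
  obtain ⟨⟨s, hsN, hs⟩, hint, hprim⟩ := hP
  have hcompact : IsCompact P := by
    rw [hs]
    exact s.finite_toSet.isCompact_convexHull ℝ
  have hconv : Convex ℝ P := by
    rw [hs]
    exact convex_convexHull ℝ _
  have hfin : (vertices P).Finite := by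
    refine s.finite_toSet.subset ?_
    rw [vertices, hs]
    exact extremePoints_convexHull_subset
  have hV : (hfin.toFinset : Set E) = vertices P := hfin.coe_toFinset
  have hhull : P = convexHull ℝ (hfin.toFinset : Set E) := by
    rw [hV]
    conv_lhs => rw [← closure_convexHull_extremePoints hcompact hconv]
    exact (hfin.isCompact_convexHull ℝ).isClosed.closure_eq
  refine ⟨hfin.toFinset, hV, hhull, interior_subset hint, ?_, ?_, ?_⟩
  · intro x hx
    obtain ⟨y, hy⟩ := exists_cross_pos_of_ne_zero b hx
    -- A small positive multiple of `y` lies in `P`; this is impossible if all vertices lie in the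
    -- half-plane `cross b x ≤ 0`.
    have hcont : Filter.Tendsto (fun c : ℝ => c • y) (nhds 0) (nhds 0) := by
      have : Continuous fun c : ℝ => c • y := continuous_id.smul continuous_const
      simpa using this.tendsto 0
    have hev := hcont.eventually (mem_interior_iff_mem_nhds.1 hint)
    obtain ⟨c, hcP, hc⟩ := ((hev.filter_mono nhdsWithin_le_nhds).and
      (self_mem_nhdsWithin : ∀ᶠ c : ℝ in nhdsWithin 0 (Set.Ioi 0), c ∈ Set.Ioi 0)).exists
    by_contra hcon
    push Not at hcon
    have hle : convexHull ℝ (hfin.toFinset : Set E) ⊆ {z | cross b x z ≤ 0} :=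
      convexHull_min (fun v hv => hcon v hv) (convex_halfSpace_le (cross b x).isLinear 0)
    rw [hhull] at hcP
    have h1 : cross b x (c • y) ≤ 0 := hle hcP
    rw [map_smul, smul_eq_mul] at h1
    have := mul_pos (Set.mem_Ioi.1 hc) hy
    linarith
  · intro u hu x hx y hy hxy
    exact (mem_extremePoints_iff_left.1 (hfin.mem_toFinset.1 hu)).2 x hx y hy hxy
  · exact fun u hu => (hprim u (hfin.mem_toFinset.1 hu)).2.1

lemma inCone_of_mem_hull {u v : E} {F : Set E} (hF : ∀ x ∈ F, InCone b u v x) {x : E}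
    (hx : x ∈ PointedCone.hull ℝ F) : InCone b u v x := by
  induction hx using Submodule.span_induction with
  | mem x hx => exact hF x hx
  | zero => simp [InCone]
  | add x y _ _ hx hy =>
    simp only [InCone, map_add, LinearMap.add_apply]
    exact ⟨add_nonneg hx.1 hy.1, add_nonneg hx.2 hy.2⟩
  | smul c x _ hx =>
    have : c • x = (c : ℝ) • x := rfl
    rw [this]
    simp only [InCone, map_smul, LinearMap.smul_apply, smul_eq_mul]
    exact ⟨mul_nonneg c.2 hx.1, mul_nonneg c.2 hx.2⟩

lemma coneDim_hull (F : Set E) :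
    coneDim (PointedCone.hull ℝ F) = finrank ℝ (Submodule.span ℝ F) := by
  rw [coneDim, Submodule.span_span_of_tower]

namespace IsPolygon

lemma inCone_of_edgeForm_eq_one (hP : IsPolygon b P V) {u v x : E} (h : IsEdge b V u v)
    (hx : x ∈ P) (hx1 : edgeForm b u v x = 1) : InCone b u v x :=
  hP.inCone_of_forall_le h fun u' v' h' => by
    rw [hx1]
    exact hP.edgeForm_le_of_mem h' hx

/-- The exposing functional has a positive maximum, since otherwise it is zero and the face is all
of `P`. Negated and divided by its maximum, it lies in a dual triangle. There it is a combination of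
two edge forms with total weight at most 1, so a form of positive weight must equal 1 on the face.
-/
lemma exists_edge_of_isExposed [FiniteDimensional ℝ E] [Nontrivial E] (hP : IsPolygon b P V)
    {F : Set E} (hF : IsExposed ℝ P F) (hFP : F ≠ P) (hne : F.Nonempty) :
    ∃ u v, IsEdge b V u v ∧ ∀ x ∈ F, edgeForm b u v x = 1 := by
  obtain ⟨l, hl⟩ := hF hne
  obtain ⟨x₀, hx₀⟩ := hne
  have hx₀' := hx₀
  rw [hl] at hx₀'
  obtain ⟨hx₀P, hmax⟩ := hx₀'
  have hFl : ∀ x ∈ F, x ∈ P ∧ l x = l x₀ := by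
    intro x hx
    rw [hl] at hx
    exact ⟨hx.1, le_antisymm (hmax x hx.1) (hx.2 x₀ hx₀P)⟩
  have hpos : 0 < l x₀ := by
    have h0 := hmax 0 hP.zero_mem
    rw [map_zero] at h0
    refine lt_of_le_of_ne h0 fun heq => hFP ?_
    have hlw : ∀ x, l x = cross b (l (b 1) • b 0 + (-l (b 0)) • b 1) x := by
      intro x
      conv_lhs => rw [eq_combo b x]
      rw [cross_apply, coord_zero_combo, coord_one_combo]
      simp only [map_add, map_smul, smul_eq_mul]
      ring
    have hw : l (b 1) • b 0 + (-l (b 0)) • b 1 = 0 := by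
      by_contra hw
      obtain ⟨v, hv, hv0⟩ := hP.exists_cross_pos _ hw
      rw [← hlw] at hv0
      have := hmax v (hP.vertex_mem hv)
      linarith
    have hlz : ∀ x, l x = 0 := by
      intro x
      rw [hlw, hw, map_zero, LinearMap.zero_apply]
    rw [hl]
    ext x
    exact ⟨fun h => h.1, fun h => ⟨h, fun y _ => by rw [hlz, hlz]⟩⟩
  have hy : (-(l x₀)⁻¹) • l ∈ dualPolytope P := by
    intro x hx
    rw [_root_.smul_apply, smul_eq_mul, neg_mul, neg_le_neg_iff, inv_mul_le_iff₀ hpos, mul_one]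
    exact hmax x hx
  obtain ⟨t, u, h, htri⟩ := hP.exists_mem_dualTriangle hy
  obtain ⟨v, h'⟩ := hP.exists_isEdge_left h.right_mem
  obtain ⟨r, s, hr, hs, hrs, heq⟩ := mem_convexHull_triangle.1 (htri v h')
  have hval : ∀ x ∈ F, r * edgeForm b t u x + s * edgeForm b u v x = 1 := by
    intro x hx
    have e := congrArg (fun f : StrongDual ℝ E => f x) heq
    simp only [_root_.add_apply, _root_.smul_apply, smul_eq_mul, dualVertex_apply,
      (hFl x hx).2] at e
    rw [neg_mul, inv_mul_cancel₀ hpos.ne'] at e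
    linarith
  have hle : ∀ x ∈ F, edgeForm b t u x ≤ 1 ∧ edgeForm b u v x ≤ 1 := fun x hx =>
    ⟨hP.edgeForm_le_of_mem h (hFl x hx).1, hP.edgeForm_le_of_mem h' (hFl x hx).1⟩
  rcases hr.eq_or_lt with hr0 | hr0
  · refine ⟨u, v, h', fun x hx => le_antisymm (hle x hx).2 ?_⟩
    have := hval x hx
    rw [← hr0, zero_mul, zero_add] at this
    rw [← hr0, zero_add] at hrs
    have h2 := mul_le_mul_of_nonneg_left (hle x hx).2 hs
    have h3 : s = 1 := by linarith
    rw [h3, one_mul] at this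
    exact this.ge
  · refine ⟨t, u, h, fun x hx => le_antisymm (hle x hx).1 ?_⟩
    have h1 := hval x hx
    have h2 := mul_le_mul_of_nonneg_left (hle x hx).2 hs
    by_contra hlt
    push Not at hlt
    have := mul_lt_mul_of_pos_left hlt hr0
    linarith

lemma hull_face_mem_faceFan [FiniteDimensional ℝ E] (hP : IsPolygon b P V) {f : E →ₗ[ℝ] ℝ}
    {F : Set E} {c : ℝ} (hc : c ≠ 0) (hne : F.Nonempty) (hle : ∀ x ∈ P, f x ≤ c)
    (hF : ∀ x, x ∈ F ↔ x ∈ P ∧ f x = c) :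
    PointedCone.hull ℝ F ∈ faceFan P := by
  refine ⟨F, fun _ => ⟨LinearMap.toContinuousLinearMap f, ?_⟩, ?_, rfl⟩
  · obtain ⟨x₀, hx₀⟩ := hne
    rw [hF] at hx₀
    ext x
    rw [hF]
    constructor
    · rintro ⟨h1, h2⟩
      refine ⟨h1, fun y hy => ?_⟩
      change f y ≤ f x
      rw [h2]
      exact hle y hy
    · rintro ⟨h1, h2⟩
      refine ⟨h1, le_antisymm (hle x h1) ?_⟩
      have h3 : f x₀ ≤ f x := h2 x₀ hx₀.1
      rwa [hx₀.2] at h3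
  · intro heq
    have h0 := hP.zero_mem
    rw [← heq, hF, map_zero] at h0
    exact hc h0.2.symm

/-- The sum of the forms of the two edges at `u` attains its maximum 2 only at `u`. -/
lemma hull_vertex_mem_faceFan [FiniteDimensional ℝ E] (hP : IsPolygon b P V) {u : E}
    (hu : u ∈ V) : PointedCone.hull ℝ {u} ∈ faceFan P := by
  obtain ⟨t, h⟩ := hP.exists_isEdge_right hu
  obtain ⟨v, h'⟩ := hP.exists_isEdge_left hu
  refine hP.hull_face_mem_faceFan (f := edgeForm b t u + edgeForm b u v) (c := 2) two_ne_zero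
    (Set.singleton_nonempty u) ?_ ?_
  · intro x hx
    have h1 := hP.edgeForm_le_of_mem h hx
    have h2 := hP.edgeForm_le_of_mem h' hx
    rw [LinearMap.add_apply]
    linarith
  · intro x
    rw [Set.mem_singleton_iff, LinearMap.add_apply]
    constructor
    · rintro rfl
      exact ⟨hP.vertex_mem hu, by
        rw [h.edgeForm_eq_one_right, h'.edgeForm_eq_one_left]
        norm_num⟩
    · rintro ⟨hx, hsum⟩
      have h1 := hP.edgeForm_le_of_mem h hx
      have h2 := hP.edgeForm_le_of_mem h' hx
      have e1 : edgeForm b t u x = 1 := by linarith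
      have e2 : edgeForm b u v x = 1 := by linarith
      have k1 := cross_mul_map (b := b) (edgeForm b t u) u v x
      have k2 := cross_mul_map (b := b) (edgeForm b u v) u v x
      rw [e1, h.edgeForm_eq_one_right] at k1
      rw [e2, h'.edgeForm_eq_one_left, h'.edgeForm_eq_one_right] at k2
      have h3 := hP.edgeForm_next_lt h h'
      have k3 : cross b u x * (1 - edgeForm b t u v) = 0 := by linarith
      have k4 : cross b u x = 0 := by
        rcases mul_eq_zero.1 k3 with h | h
        · exact h
        · linarith
      have k5 : cross b x v = cross b u v := by linarith
      rw [eq_of_cross_pos b h'.pos x, k4, k5, div_self h'.pos.ne', zero_div, one_smul, zero_smul,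
        add_zero]

/-- The value of the piecewise linear function of the anticanonical divisor. -/
lemma _root_.LDP.IsAnticanonical.eq_neg_edgeForm [FiniteDimensional ℝ E] {κ : E → ℝ}
    (hκ : IsAnticanonical N (faceFan P) κ) (hP : IsPolygon b P V)
    (hprim : ∀ u ∈ V, IsPrimitive N u) {u v x : E} (h : IsEdge b V u v)
    (hx : InCone b u v x) : κ x = -edgeForm b u v x := by
  have hvert : ∀ w ∈ V, κ w = -1 := by
    intro w hw
    refine hκ.ray_generator _ (hP.hull_vertex_mem_faceFan hw) ?_ w
      (PointedCone.subset_hull rfl) (hprim w hw)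
    rw [coneDim_hull]
    exact finrank_span_singleton (hP.ne_zero w hw)
  have hfan := hP.hull_face_mem_faceFan (f := edgeForm b u v) (c := 1)
    (F := {x | x ∈ P ∧ edgeForm b u v x = 1}) one_ne_zero
    ⟨u, hP.vertex_mem h.left_mem, h.edgeForm_eq_one_left⟩
    (fun x hx => hP.edgeForm_le_of_mem h hx) (fun x => Iff.rfl)
  obtain ⟨m, hm⟩ := hκ.linear_on_cone _ hfan
  have hu := PointedCone.subset_hull (R := ℝ) (s := {x | x ∈ P ∧ edgeForm b u v x = 1})
    ⟨hP.vertex_mem h.left_mem, h.edgeForm_eq_one_left⟩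
  have hv := PointedCone.subset_hull (R := ℝ) (s := {x | x ∈ P ∧ edgeForm b u v x = 1})
    ⟨hP.vertex_mem h.right_mem, h.edgeForm_eq_one_right⟩
  have ha : 0 ≤ cross b x v / cross b u v := div_nonneg hx.2 h.pos.le
  have hb : 0 ≤ cross b u x / cross b u v := div_nonneg hx.1 h.pos.le
  have hxm : x ∈ PointedCone.hull ℝ {x | x ∈ P ∧ edgeForm b u v x = 1} := by
    have := Submodule.add_mem _
      (Submodule.smul_mem _ (⟨_, ha⟩ : NNReal) hu) (Submodule.smul_mem _ (⟨_, hb⟩ : NNReal) hv)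
    convert this using 1
    exact eq_of_cross_pos b h.pos x
  have hmf : m = -edgeForm b u v := by
    refine linearMap_eq_of_cross_pos h.pos ?_ ?_
    · rw [← hm u hu, hvert u h.left_mem, LinearMap.neg_apply, h.edgeForm_eq_one_left]
    · rw [← hm v hv, hvert v h.right_mem, LinearMap.neg_apply, h.edgeForm_eq_one_right]
  rw [hm x hxm, hmf, LinearMap.neg_apply]

lemma isAnticanonical_of_eq [FiniteDimensional ℝ E] [Nontrivial E] (hP : IsPolygon b P V)
    (hN : N = Submodule.span ℤ (Set.range b)) (hV : (V : Set E) = vertices P)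
    (hprim : ∀ u ∈ V, IsPrimitive N u) {κ : E → ℝ}
    (hκ : ∀ u v x, IsEdge b V u v → InCone b u v x → κ x = -edgeForm b u v x) :
    IsAnticanonical N (faceFan P) κ := by
  constructor
  · rintro σ ⟨F, hF, hFP, rfl⟩
    rcases F.eq_empty_or_nonempty with rfl | hne
    · obtain ⟨u, v, h, hc⟩ := hP.exists_inCone 0
      refine ⟨0, fun x hx => ?_⟩
      rw [PointedCone.hull, Submodule.span_empty, Submodule.mem_bot] at hx
      rw [hx, hκ u v 0 h hc, map_zero, neg_zero, LinearMap.zero_apply]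
    · obtain ⟨u, v, h, h1⟩ := hP.exists_edge_of_isExposed hF hFP hne
      refine ⟨-edgeForm b u v, fun x hx => hκ u v x h (inCone_of_mem_hull (fun y hy => ?_) hx)⟩
      exact hP.inCone_of_edgeForm_eq_one h (hF.subset hy) (h1 y hy)
  · rintro σ ⟨F, hF, hFP, rfl⟩ hdim w hw hwprim
    rw [coneDim_hull] at hdim
    rcases F.eq_empty_or_nonempty with rfl | hne
    · rw [Submodule.span_empty, finrank_bot] at hdim
      exact absurd hdim zero_ne_one
    obtain ⟨u, v, h, h1⟩ := hP.exists_edge_of_isExposed hF hFP hne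
    obtain ⟨x₀, hx₀⟩ := hne
    have hx₀0 : x₀ ≠ 0 := by
      rintro rfl
      have := h1 0 hx₀
      rw [map_zero] at this
      exact zero_ne_one this
    have hline : ∀ x ∈ Submodule.span ℝ F, x = edgeForm b u v x • x₀ := by
      intro x hx
      have hz : (⟨x₀, Submodule.subset_span hx₀⟩ : Submodule.span ℝ F) ≠ 0 := by
        intro h0
        exact hx₀0 (congrArg Subtype.val h0)
      obtain ⟨c, hc⟩ := (finrank_eq_one_iff_of_nonzero' _ hz).1 hdim ⟨x, hx⟩
      have hc' : c • x₀ = x := congrArg Subtype.val hc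
      rw [← hc', map_smul, h1 x₀ hx₀, smul_eq_mul, mul_one]
    -- A face that spans a line and lies at height 1 is a single point, hence a vertex. The
    -- primitive vector `w` is a nonnegative integral multiple of it, hence equal to it.
    have hFs : F = {x₀} := by
      refine Set.eq_singleton_iff_unique_mem.2 ⟨hx₀, fun x hx => ?_⟩
      rw [hline x (Submodule.subset_span hx), h1 x hx, one_smul]
    have hx₀V : x₀ ∈ V := by
      have : x₀ ∈ vertices P := by
        rw [hFs] at hF
        exact isExtreme_singleton.1 hF.isExtreme
      rwa [← hV] at this
    have hwc : InCone b u v w := inCone_of_mem_hull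
      (fun y hy => hP.inCone_of_edgeForm_eq_one h (hF.subset hy) (h1 y hy)) hw
    have hweq := hline w (PointedCone.hull_le_span ℝ F hw)
    obtain ⟨p, q, hpq, hx₀eq⟩ := (hprim x₀ hx₀V).exists_coprime hN
    obtain ⟨k, hk⟩ : ∃ k : ℤ, edgeForm b u v w = k := by
      refine exists_int_of_smul (b := b) hpq ?_
      rw [← hx₀eq, ← hweq, ← mem_span_iff_isIntegral, ← hN]
      exact hwprim.1
    have hk0 : (0 : ℝ) ≤ k := by
      rw [← hk, edgeForm_apply]
      exact div_nonneg (add_nonneg hwc.1 hwc.2) h.pos.le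
    have hku : IsUnit k := by
      refine hwprim.2.2 x₀ (hprim x₀ hx₀V).1 k ?_
      rw [hk] at hweq
      rw [← Int.cast_smul_eq_zsmul ℝ]
      exact hweq
    have hk1 : k = 1 := by
      have : 0 ≤ k := by exact_mod_cast hk0
      rcases Int.isUnit_iff.1 hku with h | h <;> omega
    rw [hκ u v w h hwc, hk, hk1]
    norm_num

lemma existsUnique_isAnticanonical [FiniteDimensional ℝ E] [Nontrivial E]
    (hP : IsPolygon b P V) (hN : N = Submodule.span ℤ (Set.range b))
    (hV : (V : Set E) = vertices P) (hprim : ∀ u ∈ V, IsPrimitive N u) :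
    ∃! κ : E → ℝ, IsAnticanonical N (faceFan P) κ := by
  choose u v h hc using fun x => hP.exists_inCone x
  refine ⟨fun x => -edgeForm b (u x) (v x) x, hP.isAnticanonical_of_eq hN hV hprim ?_, ?_⟩
  · intro u' v' x h' hx
    rw [neg_inj]
    exact le_antisymm (h'.edgeForm_le_of_inCone (h x) hx) ((h x).edgeForm_le_of_inCone h' (hc x))
  · intro κ hκ
    funext x
    exact hκ.eq_neg_edgeForm hP hprim (h x) (hc x)

end IsPolygon

end Fan

/-! ### Assembling the formula and the equality case -/

section Main

variable {E : Type*} [NormedAddCommGroup E] [NormedSpace ℝ E] {N : Submodule ℤ E}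
  {b : Basis (Fin 2) ℝ E} {P : Set E} {V : Finset E}

open Classical in
/-- The contribution of the lattice points in the open cone over an edge. -/
noncomputable def edgeSum (b : Basis (Fin 2) ℝ E) (A : Finset E) (σ : E × E) : ℝ :=
  ∑ n ∈ A.filter (fun n => 0 < cross b σ.1 n ∧ 0 < cross b n σ.2),
    (1 - edgeForm b σ.1 σ.2 n) ^ 2

lemma edgeSum_nonneg (A : Finset E) (σ : E × E) : 0 ≤ edgeSum b A σ :=
  Finset.sum_nonneg fun _ _ => sq_nonneg _

namespace IsPolygon

lemma mem_filter_cone_iff (hP : IsPolygon b P V) (hN : N = Submodule.span ℤ (Set.range b))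
    {A : Finset E} (hA : ∀ n, n ∈ A ↔ n ∈ P ∧ n ∈ N) {u v : E} (h : IsEdge b V u v) (n : E) :
    n ∈ A ∧ (0 < cross b u n ∧ 0 < cross b n v) ↔
      IsIntegral b n ∧ 0 < cross b u n ∧ 0 < cross b n v ∧ edgeForm b u v n ≤ 1 := by
  rw [hA, hN, mem_span_iff_isIntegral]
  constructor
  · rintro ⟨⟨h1, h2⟩, h3, h4⟩
    exact ⟨h2, h3, h4, hP.edgeForm_le_of_mem h h1⟩
  · rintro ⟨h2, h3, h4, h5⟩
    exact ⟨⟨hP.mem_of_inCone h ⟨h3.le, h4.le⟩ h5, h2⟩, h3, h4⟩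

/-- A nonzero lattice point of the polygon on the ray through a vertex is that vertex. -/
lemma eq_of_smul_integral (hP : IsPolygon b P V) (hN : N = Submodule.span ℤ (Set.range b))
    (hprim : ∀ u ∈ V, IsPrimitive N u) {u : E} (hu : u ∈ V) {c : ℝ} (hc : 0 ≤ c)
    (hcP : c • u ∈ P) (hcN : c • u ∈ N) (h0 : c • u ≠ 0) : c = 1 := by
  obtain ⟨p, q, hpq, heq⟩ := (hprim u hu).exists_coprime hN
  rw [hN, mem_span_iff_isIntegral, heq] at hcN
  obtain ⟨k, hk⟩ := exists_int_of_smul hpq hcN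
  have h1 := hP.le_one_of_smul_mem hu hcP
  have h2 : c ≠ 0 := by
    rintro rfl
    exact h0 (zero_smul ℝ u)
  rw [hk] at h1 h2 hc ⊢
  have h3 : k ≤ 1 := by exact_mod_cast h1
  have h4 : k ≠ 0 := by exact_mod_cast h2
  have h5 : 0 ≤ k := by exact_mod_cast hc
  have : k = 1 := by omega
  rw [this, Int.cast_one]

/-- The origin accounts for the 1, lattice points on rays are vertices and drop out because `κ = -1`
there, and any other point lies in exactly one open cone. -/
lemma sum_anticanonical [FiniteDimensional ℝ E] [Nontrivial E] (hP : IsPolygon b P V)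
    (hN : N = Submodule.span ℤ (Set.range b)) (hprim : ∀ u ∈ V, IsPrimitive N u)
    {A : Finset E} (hA : ∀ n, n ∈ A ↔ n ∈ P ∧ n ∈ N) {κ : E → ℝ}
    (hκ : IsAnticanonical N (faceFan P) κ) :
    ∑ n ∈ A, (κ n + 1) ^ 2 = 1 + ∑ σ ∈ edges b V, edgeSum b A σ := by
  classical
  have hpt : ∀ n ∈ A, (κ n + 1) ^ 2 = (if n = 0 then 1 else 0) +
      ∑ σ ∈ edges b V, if 0 < cross b σ.1 n ∧ 0 < cross b n σ.2 then
        (1 - edgeForm b σ.1 σ.2 n) ^ 2 else 0 := by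
    intro n hn
    obtain ⟨hnP, hnN⟩ := (hA n).1 hn
    obtain ⟨u, v, h, hc⟩ := hP.exists_inCone n
    have hκn := hκ.eq_neg_edgeForm hP hprim h hc
    by_cases hstrict : 0 < cross b u n ∧ 0 < cross b n v
    · have hn0 : n ≠ 0 := by
        rintro rfl
        simp at hstrict
      rw [if_neg hn0, zero_add, Finset.sum_eq_single (u, v)]
      · rw [if_pos hstrict, hκn]
        ring
      · intro τ hτ hne
        rw [if_neg]
        rintro ⟨h1, h2⟩
        have := hP.eq_of_inCone_of_pos (mem_edges.1 hτ) h h1 h2 hc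
        exact hne (Prod.ext this.1 this.2)
      · exact fun hnot => absurd (mem_edges.2 h) hnot
    · rw [Finset.sum_eq_zero, add_zero]
      · split_ifs with hn0
        · rw [hκn, hn0, map_zero]
          norm_num
        · suffices h1 : edgeForm b u v n = 1 by
            rw [hκn, h1]
            norm_num
          have hray : ∀ w ∈ V, ∀ c : ℝ, 0 ≤ c → n = c • w → edgeForm b u v w = 1 →
              edgeForm b u v n = 1 := by
            intro w hw c hc0 hnw hw1
            rw [hnw] at hnP hnN hn0
            rw [hnw, hP.eq_of_smul_integral hN hprim hw hc0 hnP hnN hn0, one_smul, hw1]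
          have hneq := eq_of_cross_pos b h.pos n
          rcases hc.1.eq_or_lt with h1 | h1
          · rw [← h1, zero_div, zero_smul, add_zero] at hneq
            exact hray u h.left_mem _ (div_nonneg hc.2 h.pos.le) hneq h.edgeForm_eq_one_left
          · have h2 : cross b n v = 0 := by
              by_contra hne
              exact hstrict ⟨h1, lt_of_le_of_ne hc.2 (Ne.symm hne)⟩
            rw [h2, zero_div, zero_smul, zero_add] at hneq
            exact hray v h.right_mem _ (div_nonneg hc.1 h.pos.le) hneq h.edgeForm_eq_one_right
      · intro τ hτ
        rw [if_neg]
        rintro ⟨h1, h2⟩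
        have := hP.eq_of_inCone_of_pos (mem_edges.1 hτ) h h1 h2 hc
        rw [this.1] at h1
        rw [this.2] at h2
        exact hstrict ⟨h1, h2⟩
  have h0A : (0 : E) ∈ A := (hA 0).2 ⟨hP.zero_mem, N.zero_mem⟩
  rw [Finset.sum_congr rfl hpt, Finset.sum_add_distrib, Finset.sum_ite_eq' A (0 : E), if_pos h0A,
    Finset.sum_comm]
  congr 1
  refine Finset.sum_congr rfl fun σ _ => ?_
  rw [edgeSum, Finset.sum_filter]

/-- Integer coordinates of the vertices. -/
lemma exists_coordinates (hN : N = Submodule.span ℤ (Set.range b))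
    (hprim : ∀ u ∈ V, IsPrimitive N u) :
    ∃ p q : E → ℤ, (∀ u ∈ V, IsCoprime (p u) (q u)) ∧
      ∀ u ∈ V, u = (p u : ℝ) • b 0 + (q u : ℝ) • b 1 := by
  choose! p q h1 h2 using fun (u : E) (hu : u ∈ V) => (hprim u hu).exists_coprime hN
  exact ⟨p, q, h1, h2⟩

lemma volume_add_volume_dual [FiniteDimensional ℝ E] [Nontrivial E] [MeasurableSpace E]
    [BorelSpace E] (hP : IsPolygon b P V) (hN : N = Submodule.span ℤ (Set.range b))
    (hprim : ∀ u ∈ V, IsPrimitive N u) {A : Finset E} (hA : ∀ n, n ∈ A ↔ n ∈ P ∧ n ∈ N) :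
    normalizedVolume N P + normalizedVolume (dualLattice N) (dualPolytope P) =
      12 * (1 + ∑ σ ∈ edges b V, edgeSum b A σ) := by
  classical
  obtain ⟨next, hnext⟩ := hP.exists_next
  obtain ⟨p, q, hcop, hpq⟩ := exists_coordinates hN hprim
  -- The part outside the determinant is exactly the summand in Noether's formula.
  have hloc : ∀ σ ∈ edges b V, ∃ h : ℤ, (p σ.1 * q σ.2 - q σ.1 * p σ.2) ∣ p σ.2 - h * p σ.1 ∧
      (p σ.1 * q σ.2 - q σ.1 * p σ.2) ∣ q σ.2 - h * q σ.1 ∧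
      12 * edgeSum b A σ = cross b σ.1 σ.2 + (2 / cross b σ.1 σ.2 - 3 -
        12 * dedekindSum h (p σ.1 * q σ.2 - q σ.1 * p σ.2)) := by
    intro σ hσ
    have hσ' := mem_edges.1 hσ
    obtain ⟨h, h1, h2, h3, h4⟩ := exists_sum_triangle (b := b) (hpq _ hσ'.left_mem)
      (hpq _ hσ'.right_mem) (hcop _ hσ'.left_mem) (hcop _ hσ'.right_mem) hσ'.pos
      (A.filter (fun n => 0 < cross b σ.1 n ∧ 0 < cross b n σ.2)) (fun n => by
        rw [Finset.mem_filter]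
        exact hP.mem_filter_cone_iff hN hA hσ' n)
    refine ⟨h, h1, h2, ?_⟩
    have hd : cross b σ.1 σ.2 = (p σ.1 * q σ.2 - q σ.1 * p σ.2 : ℤ) := by
      conv_lhs => rw [hpq _ hσ'.left_mem, hpq _ hσ'.right_mem]
      rw [cross_combo]
      push_cast
      ring
    have hd0 : 0 < p σ.1 * q σ.2 - q σ.1 * p σ.2 := by
      have := hσ'.pos
      rw [hd] at this
      exact_mod_cast this
    rw [sum_fract_sub_sq hd0 h3] at h4
    rw [hd, edgeSum]
    linear_combination 6 * h4
  choose! h h1 h2 h3 using hloc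
  have hnoe := hP.noether p q hpq hcop h h1 h2 next hnext
  rw [hP.normalizedVolume_eq hN, hP.normalizedVolume_dual_eq hN next hnext, ← hnoe, mul_add,
    Finset.mul_sum, Finset.sum_congr rfl h3, Finset.sum_add_distrib]
  ring

lemma dualVertex_mem_iff_edgeSum_eq_zero [FiniteDimensional ℝ E] (hP : IsPolygon b P V)
    (hN : N = Submodule.span ℤ (Set.range b)) (hprim : ∀ u ∈ V, IsPrimitive N u) {A : Finset E}
    (hA : ∀ n, n ∈ A ↔ n ∈ P ∧ n ∈ N) {u v : E} (hσ : IsEdge b V u v) :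
    dualVertex b u v ∈ dualLattice N ↔ edgeSum b A (u, v) = 0 := by
  classical
  constructor
  · intro hmem
    refine Finset.sum_eq_zero fun n hn => ?_
    obtain ⟨hnA, h1, h2⟩ := Finset.mem_filter.1 hn
    obtain ⟨hnP, hnN⟩ := (hA n).1 hnA
    obtain ⟨k, hk⟩ := hmem n hnN
    rw [dualVertex_apply] at hk
    have hle := hP.edgeForm_le_of_mem hσ hnP
    have hpos : 0 < edgeForm b u v n := by
      rw [edgeForm_apply]
      exact div_pos (add_pos h1 h2) hσ.pos
    have hk1 : (k : ℝ) < 0 := by linarith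
    have hk2 : (-1 : ℝ) ≤ k := by linarith
    have hk1' : k < 0 := by exact_mod_cast hk1
    have hk2' : -1 ≤ k := by exact_mod_cast hk2
    have hk3 : k = -1 := by omega
    rw [hk3] at hk
    push_cast at hk
    rw [show edgeForm b u v n = 1 by linarith]
    norm_num
  · intro hzero
    obtain ⟨p, q, hpq, hu⟩ := (hprim u hσ.left_mem).exists_coprime hN
    obtain ⟨p', q', hpq', hv⟩ := (hprim v hσ.right_mem).exists_coprime hN
    obtain ⟨h, h1, h2, h3, h4⟩ := exists_sum_triangle (b := b) hu hv hpq hpq' hσ.pos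
      (A.filter (fun n => 0 < cross b u n ∧ 0 < cross b n v)) (fun n => by
        rw [Finset.mem_filter]
        exact hP.mem_filter_cone_iff hN hA hσ n)
    have hd : cross b u v = (p * q' - q * p' : ℤ) := by
      rw [hu, hv, cross_combo]
      push_cast
      ring
    obtain ⟨d, hdd⟩ : ∃ d, d = p * q' - q * p' := ⟨_, rfl⟩
    rw [← hdd] at h1 h2 h3 h4 hd
    have hd0 : 0 < d := by
      have := hσ.pos
      rw [hd] at this
      exact_mod_cast this
    have hdR : (d : ℝ) ≠ 0 := by exact_mod_cast hd0.ne'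
    have hdvd : d ∣ h - 1 := by
      by_cases hd1 : d = 1
      · rw [hd1]
        exact one_dvd _
      have hz : ∑ n ∈ A.filter (fun n => 0 < cross b u n ∧ 0 < cross b n v),
          (1 - edgeForm b u v n) ^ 2 = 0 := hzero
      rw [hz, mul_zero] at h4
      -- The term `j = 1` reads `{h/d} = 1/d`, that is `h ≡ 1` mod `d`. It exists only if `d > 1`.
      have := (Finset.sum_eq_zero_iff_of_nonneg (fun _ _ => sq_nonneg _)).1 h4.symm 1
        (Finset.mem_Ioo.2 ⟨by norm_num, by omega⟩)
      have h5 := pow_eq_zero_iff two_ne_zero |>.1 this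
      rw [Int.fract] at h5
      refine ⟨⌊(h * (1 : ℤ) : ℝ) / d⌋, ?_⟩
      set f := ⌊(h * (1 : ℤ) : ℝ) / d⌋
      push_cast at h5
      field_simp at h5
      have h6 : (h : ℝ) - 1 = d * f := by linarith
      exact_mod_cast h6
    have hp : d ∣ p' - p := by
      have := dvd_add h1 (hdvd.mul_right p)
      rwa [show p' - h * p + (h - 1) * p = p' - p by ring] at this
    have hq : d ∣ q' - q := by
      have := dvd_add h2 (hdvd.mul_right q)
      rwa [show q' - h * q + (h - 1) * q = q' - q by ring] at this
    obtain ⟨x, hx⟩ := hp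
    obtain ⟨y, hy⟩ := hq
    have hxR : (p' : ℝ) - p = d * x := by exact_mod_cast hx
    have hyR : (q' : ℝ) - q = d * y := by exact_mod_cast hy
    intro n hn
    rw [hN] at hn
    obtain ⟨i, j, rfl⟩ := mem_span_iff_isIntegral.1 hn
    -- Since `v - u = d (x, y)`, the edge form is the determinant with the integral vector `(x, y)`.
    refine ⟨j * x - i * y, ?_⟩
    rw [dualVertex_apply, edgeForm_apply, hd, hu, hv, cross_combo, cross_combo]
    push_cast
    field_simp
    linear_combination (-i : ℝ) * hyR + (j : ℝ) * hxR

end IsPolygon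

end Main

/-- A basis of a lattice in a plane is a basis of the plane. -/
lemma exists_basis_span_eq {E : Type*} [NormedAddCommGroup E] [NormedSpace ℝ E]
    [FiniteDimensional ℝ E] (hE : finrank ℝ E = 2) (N : Submodule ℤ E) [DiscreteTopology N]
    [IsZLattice ℝ N] : ∃ b : Basis (Fin 2) ℝ E, N = Submodule.span ℤ (Set.range b) := by
  have : Module.Finite ℤ N := ZLattice.module_finite ℝ N
  have : Module.Free ℤ N := ZLattice.module_free ℝ N
  have hrank : finrank ℤ N = 2 := by rw [ZLattice.rank ℝ N, hE]
  let b := finBasisOfFinrankEq ℤ N hrank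
  exact ⟨b.ofZLatticeBasis ℝ N, (b.ofZLatticeBasis_span ℝ).symm⟩

end LDP

theorem corollary4p5 {E : Type*} [NormedAddCommGroup E] [NormedSpace ℝ E] [FiniteDimensional ℝ E]
    [MeasurableSpace E] [BorelSpace E] (hE : Module.finrank ℝ E = 2)
    (N : Submodule ℤ E) [DiscreteTopology N] [IsZLattice ℝ N]
    (Δ : Set E) (hΔ : LDP.IsLDP N Δ) :
    (Δ ∩ N).Finite ∧
    (∃! κ : E → ℝ, LDP.IsAnticanonical N (LDP.faceFan Δ) κ) ∧
    (∀ κ : E → ℝ, LDP.IsAnticanonical N (LDP.faceFan Δ) κ →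
      LDP.normalizedVolume N Δ
          + LDP.normalizedVolume (LDP.dualLattice N) (LDP.dualPolytope Δ) =
        12 * ∑ᶠ n ∈ Δ ∩ N, (κ n + 1) ^ 2) ∧
    12 ≤ LDP.normalizedVolume N Δ
          + LDP.normalizedVolume (LDP.dualLattice N) (LDP.dualPolytope Δ) ∧
    (LDP.normalizedVolume N Δ
          + LDP.normalizedVolume (LDP.dualLattice N) (LDP.dualPolytope Δ) = 12 ↔
      LDP.IsReflexive N Δ) := by
  obtain ⟨b, hN⟩ := LDP.exists_basis_span_eq hE N
  have hnt : Nontrivial E := Module.nontrivial_of_finrank_pos (R := ℝ) (by omega)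
  obtain ⟨V, hV, hP⟩ := hΔ.exists_isPolygon b
  have hprim : ∀ u ∈ V, LDP.IsPrimitive N u := by
    intro u hu
    refine hΔ.primitive_vertices u ?_
    rw [← hV]
    exact hu
  have hfin : (Δ ∩ N).Finite := by
    have hbdd : Bornology.IsBounded Δ := by
      rw [hP.eq_hull]
      exact (V.finite_toSet.isCompact_convexHull ℝ).isBounded
    rw [hN]
    exact ZSpan.setFinite_inter b hbdd
  have hA : ∀ n, n ∈ hfin.toFinset ↔ n ∈ Δ ∧ n ∈ N := fun n => hfin.mem_toFinset
  have hvol := hP.volume_add_volume_dual hN hprim hA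
  have hnn : 0 ≤ ∑ σ ∈ LDP.edges b V, LDP.edgeSum b hfin.toFinset σ :=
    Finset.sum_nonneg fun σ _ => LDP.edgeSum_nonneg _ σ
  refine ⟨hfin, hP.existsUnique_isAnticanonical hN hV hprim, fun κ hκ => ?_, ?_, ?_⟩
  · rw [hvol, finsum_mem_eq_finite_toFinset_sum _ hfin, hP.sum_anticanonical hN hprim hA hκ]
  · rw [hvol]
    linarith
  · rw [hvol, LDP.IsReflexive, LDP.vertices, hP.extremePoints_dualPolytope]
    have h1 : 12 * (1 + ∑ σ ∈ LDP.edges b V, LDP.edgeSum b hfin.toFinset σ) = 12 ↔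
        ∑ σ ∈ LDP.edges b V, LDP.edgeSum b hfin.toFinset σ = 0 := by
      constructor <;> intro h <;> linarith
    rw [h1, Finset.sum_eq_zero_iff_of_nonneg fun σ _ => LDP.edgeSum_nonneg _ σ]
    constructor
    · rintro h _ ⟨u, v, huv, rfl⟩
      exact (hP.dualVertex_mem_iff_edgeSum_eq_zero hN hprim hA huv).2
        (h (u, v) (LDP.mem_edges.2 huv))
    · intro h σ hσ
      have hσ' := LDP.mem_edges.1 hσ
      exact (hP.dualVertex_mem_iff_edgeSum_eq_zero hN hprim hA hσ').1 (h ⟨_, _, hσ', rfl⟩)
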